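/- Let $X$ be a smooth projective toric variety over an algebraically closed field $k$, let $S$ be its Cox ring, graded by $\operatorname{Pic}(X)$, and let $B\subseteq S$ be its irrelevant ideal. For a $\operatorname{Pic}(X)$-graded $S$-module $P$, let $\widetilde P$ (also written $P^\sim$) denote the associated sheaf of $\mathcal O_X$-modules. A virtual resolution of a finitely generated $\operatorname{Pic}(X)$-graded $S$-module $M$ is a complex $F_\bullet=[F_0\leftarrow F_1\leftarrow F_2\leftarrow\cdots]$ of finitely generated graded free $S$-modules, with differentials homogeneous of degree $0$, for which there is a morphism of $\mathcal O_X$-modules $\widetilde F_0\to\widetilde M$ making the sequence of sheaves $0\leftarrow\widetilde M\leftarrow\widetilde F_0\leftarrow\widetilde F_1\leftarrow\widetilde F_2\leftarrow\cdots$ exact. It has length (at most) $\ell$ if $F_i=0$ for all $i>\ell$. Let $M$ be a finitely generated $\operatorname{Pic}(X)$-graded $S$-module. 1. If $F_\bullet$ is any virtual resolution of $M$, then for every finitely generated $\operatorname{Pic}(X)$-graded $S$-module $N$ and every $i\ge 0$ there is an isomorphism of sheaves of $\mathcal O_X$-modules $$\operatorname{Ext}^i_S(M,N)^\sim\;\cong\;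 H^i\bigl(\operatorname{Hom}_S(F_\bullet,N)\bigr)^\sim ,$$ where $\operatorname{Ext}^i_S(M,N)$ and $H^i(\operatorname{Hom}_S(F_\bullet,N))$ carry their natural $\operatorname{Pic}(X)$-gradings. 2. Consequently, if $M$ has a virtual resolution of length $\ell$, then $\operatorname{Ext}^i_S(M,N)^\sim=0$ for every finitely generated $\operatorname{Pic}(X)$-graded $S$-module $N$ and all $i>\ell$. -/

import Mathlib

open CategoryTheory TopologicalSpace Opposite

universe u

set_option linter.unusedSectionVars false

noncomputable section

/-! ### Graded modules over a graded ring -/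

section GradedModules

variable {A : Type} [AddCommGroup A] [DecidableEq A] {k : Type u} {S : Type u} [CommRing k]
  [CommRing S] [Algebra k S]

/-- An `A`-graded module over the `A`-graded ring `S = ⨁ 𝒜 a`: an `S`-module that is the internal
direct sum of the additive subgroups `deg a`, with `𝒜 a • deg b ⊆ deg (a + b)`. -/
structure GrMod (𝒜 : A → Submodule k S) where
  carrier : Type u
  [addCommGroup : AddCommGroup carrier]
  [module : Module S carrier]
  deg : A → AddSubgroup carrier
  isInternal : DirectSum.IsInternal deg
  smul_mem : ∀ {a b : A} {s : S} {m : carrier}, s ∈ 𝒜 a → m ∈ deg b → s • m ∈ deg (a + b)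

attribute [instance] GrMod.addCommGroup GrMod.module

/-- Criterion for an internal direct sum decomposition. -/
theorem isInternal_of_sum {M : Type u} [AddCommGroup M] (deg : A → AddSubgroup M)
    (h1 : ∀ m : M, ∃ (s : Finset A) (f : A → M), (∀ a, f a ∈ deg a) ∧ ∑ a ∈ s, f a = m)
    (h2 : ∀ (s : Finset A) (f : A → M), (∀ a, f a ∈ deg a) → ∑ a ∈ s, f a = 0 →
      ∀ a ∈ s, f a = 0) : DirectSum.IsInternal deg := by
  classical
  constructor
  · rw [injective_iff_map_eq_zero]
    intro x hx
    rw [DirectSum.coeAddMonoidHom_eq_dfinsuppSum, DFinsupp.sum] at hx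
    have := h2 x.support (fun a => (x a : M)) (fun a => (x a).2) hx
    ext a
    by_cases ha : a ∈ x.support
    · simpa using this a ha
    · simpa using ha
  · intro m
    obtain ⟨s, f, hf, rfl⟩ := h1 m
    refine ⟨∑ a ∈ s, DirectSum.of (fun a => deg a) a ⟨f a, hf a⟩, ?_⟩
    simp [map_sum]

namespace GrMod

variable {𝒜 : A → Submodule k S}

/-- The projection of a graded module onto its component of degree `a`. -/
def proj (M : GrMod 𝒜) (a : A) : M.carrier →+ M.carrier :=
  letI := M.isInternal.chooseDecomposition
  AddMonoidHom.mk' (fun m => (DirectSum.decompose M.deg m a : M.carrier)) (by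
    intro x y
    simp [DirectSum.decompose_add])

theorem proj_mem (M : GrMod 𝒜) (a : A) (m : M.carrier) : M.proj a m ∈ M.deg a := by
  simp [proj]

theorem proj_same (M : GrMod 𝒜) {a : A} {m : M.carrier} (h : m ∈ M.deg a) :
    M.proj a m = m := by
  let := M.isInternal.chooseDecomposition
  exact DirectSum.decompose_of_mem_same M.deg h

theorem proj_ne (M : GrMod 𝒜) {a b : A} {m : M.carrier} (h : m ∈ M.deg a) (hab : a ≠ b) :
    M.proj b m = 0 := by
  let := M.isInternal.chooseDecomposition
  exact DirectSum.decompose_of_mem_ne M.deg h hab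

theorem exists_sum_proj (M : GrMod 𝒜) (m : M.carrier) :
    ∃ s : Finset A, ∀ t : Finset A, s ⊆ t → ∑ a ∈ t, M.proj a m = m := by
  classical
  let := M.isInternal.chooseDecomposition
  refine ⟨(DirectSum.decompose M.deg m).support, fun t ht => ?_⟩
  conv_rhs => rw [← DirectSum.sum_support_decompose M.deg m]
  symm
  refine Finset.sum_subset ht fun a _ ha => ?_
  simpa using ha

theorem proj_sum (M : GrMod 𝒜) {s : Finset A} {f : A → M.carrier} (hf : ∀ a, f a ∈ M.deg a)
    {a : A} (ha : a ∈ s) : M.proj a (∑ b ∈ s, f b) = f a := by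
  rw [map_sum, Finset.sum_eq_single_of_mem a ha, M.proj_same (hf a)]
  intro b _ hb
  exact M.proj_ne (hf b) hb

variable [GradedAlgebra 𝒜]

theorem exists_sum_decompose (r : S) :
    ∃ s : Finset A, ∀ t : Finset A, s ⊆ t → ∑ a ∈ t, (DirectSum.decompose 𝒜 r a : S) = r := by
  classical
  refine ⟨(DirectSum.decompose 𝒜 r).support, fun t ht => ?_⟩
  conv_rhs => rw [← DirectSum.sum_support_decompose 𝒜 r]
  symm
  refine Finset.sum_subset ht fun a _ ha => ?_
  simpa using ha

theorem proj_smul (M : GrMod 𝒜) (r : S) {m : M.carrier} {b : A} (hm : m ∈ M.deg b) (c : A) :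
    M.proj c (r • m) = (DirectSum.decompose 𝒜 r (c - b) : S) • m := by
  obtain ⟨s, hs⟩ := exists_sum_decompose (𝒜 := 𝒜) r
  have h := hs (insert (c - b) s) (Finset.subset_insert _ _)
  conv_lhs => rw [← h, Finset.sum_smul, map_sum]
  rw [Finset.sum_eq_single_of_mem (c - b) (Finset.mem_insert_self _ _)]
  · apply M.proj_same
    have := M.smul_mem (SetLike.coe_mem (DirectSum.decompose 𝒜 r (c - b))) hm
    rwa [sub_add_cancel] at this
  · intro e _ he
    refine M.proj_ne (M.smul_mem (SetLike.coe_mem (DirectSum.decompose 𝒜 r e)) hm) ?_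
    intro h
    exact he (by rw [← h]; abel)

/-- An `S`-submodule of a graded module is homogeneous if it contains the homogeneous components
of its elements. -/
def IsHomog (M : GrMod 𝒜) (Z : Submodule S M.carrier) : Prop :=
  ∀ z ∈ Z, ∀ a, M.proj a z ∈ Z

/-- The graded module `Z / (Z ∩ Y)` for homogeneous submodules `Y, Z` of a graded module. Its
component of degree `a` consists of the classes of the elements of `Z` of degree `a`. -/
def subquotient (M : GrMod 𝒜) (Z Y : Submodule S M.carrier) (hZ : M.IsHomog Z)
    (hY : M.IsHomog Y) : GrMod 𝒜 where
  carrier := Z ⧸ Y.submoduleOf Z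
  deg a := ((M.deg a).comap Z.subtype.toAddMonoidHom).map
    (Y.submoduleOf Z).mkQ.toAddMonoidHom
  isInternal := by
    refine isInternal_of_sum _ ?_ ?_
    · intro q
      obtain ⟨z, rfl⟩ := Submodule.Quotient.mk_surjective _ q
      obtain ⟨s, hs⟩ := M.exists_sum_proj z.1
      refine ⟨s, fun a => (Y.submoduleOf Z).mkQ ⟨M.proj a z.1, hZ _ z.2 a⟩, ?_, ?_⟩
      · intro a
        exact ⟨⟨M.proj a z.1, hZ _ z.2 a⟩, M.proj_mem a z.1, rfl⟩
      · rw [← map_sum, Submodule.mkQ_apply]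
        congr 1
        ext
        simpa using hs s subset_rfl
    · intro s f hf h a ha
      choose g hg1 hg2 using hf
      have h3 : ∑ a ∈ s, g a ∈ Y.submoduleOf Z := by
        rw [← Submodule.ker_mkQ (Y.submoduleOf Z), LinearMap.mem_ker, map_sum, ← h]
        exact Finset.sum_congr rfl fun b _ => hg2 b
      have h4 : ∑ a ∈ s, (g a : M.carrier) ∈ Y := by
        simpa [Submodule.submoduleOf] using h3
      have h5 := hY _ h4 a
      rw [M.proj_sum (f := fun a => (g a : M.carrier)) hg1 ha] at h5
      rw [← hg2 a]
      exact (Submodule.Quotient.mk_eq_zero _).2 h5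
  smul_mem := by
    rintro a b s _ hs ⟨z, hz, rfl⟩
    exact ⟨s • z, M.smul_mem hs hz, rfl⟩

/-- A homogeneous submodule of a graded module, as a graded module. -/
def ofSubmodule (M : GrMod 𝒜) (Z : Submodule S M.carrier) (hZ : M.IsHomog Z) : GrMod 𝒜 where
  carrier := Z
  deg a := (M.deg a).comap Z.subtype.toAddMonoidHom
  isInternal := by
    refine isInternal_of_sum _ ?_ ?_
    · intro z
      obtain ⟨s, hs⟩ := M.exists_sum_proj z.1
      refine ⟨s, fun a => ⟨M.proj a z.1, hZ _ z.2 a⟩, fun a => M.proj_mem a z.1, ?_⟩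
      ext
      simpa using hs s subset_rfl
    · intro s f hf h a ha
      have h4 : ∑ a ∈ s, (f a : M.carrier) = 0 := by
        simpa using congrArg Subtype.val h
      have h5 := M.proj_sum (f := fun a => (f a : M.carrier)) hf ha
      rw [h4, map_zero] at h5
      ext
      exact h5.symm
  smul_mem := fun hs hz => M.smul_mem hs hz

/-- A homomorphism of graded modules: an `S`-linear map that preserves degrees. -/
structure Hom (M N : GrMod 𝒜) where
  toLin : M.carrier →ₗ[S] N.carrier
  map_deg : ∀ {a : A} {m : M.carrier}, m ∈ M.deg a → toLin m ∈ N.deg a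

/-- Composition of homomorphisms of graded modules. -/
def Hom.comp {M N P : GrMod 𝒜} (g : N.Hom P) (f : M.Hom N) : M.Hom P where
  toLin := g.toLin ∘ₗ f.toLin
  map_deg := fun h => g.map_deg (f.map_deg h)

theorem Hom.proj_comm {M N : GrMod 𝒜} (f : M.Hom N) (a : A) (m : M.carrier) :
    N.proj a (f.toLin m) = f.toLin (M.proj a m) := by
  obtain ⟨s, hs⟩ := M.exists_sum_proj m
  have h := hs (insert a s) (Finset.subset_insert _ _)
  conv_lhs => rw [← h, map_sum]
  exact N.proj_sum (f := fun b => f.toLin (M.proj b m))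
    (fun b => f.map_deg (M.proj_mem b m)) (Finset.mem_insert_self _ _)

theorem Hom.isHomog_ker {M N : GrMod 𝒜} (f : M.Hom N) : M.IsHomog (LinearMap.ker f.toLin) := by
  intro z hz a
  rw [LinearMap.mem_ker] at hz ⊢
  rw [← f.proj_comm, hz, map_zero]

/-- A graded module is (finitely generated and) graded free if it has a finite basis of
homogeneous elements, i.e. if it is a finite direct sum of twists `S(-d j)`. -/
def IsGrFree (F : GrMod 𝒜) : Prop :=
  ∃ (n : ℕ) (b : Module.Basis (Fin n) S F.carrier) (d : Fin n → A), ∀ j, b j ∈ F.deg (d j)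

/-- The `S`-module `Hom_S(F, N)` of all `S`-linear maps, graded by the degree of a map: the
component of degree `a` consists of the `φ` with `φ (F_c) ⊆ N_{a + c}` for all `c`. -/
def homGr (F N : GrMod 𝒜) (hF : F.IsGrFree) : GrMod 𝒜 where
  carrier := F.carrier →ₗ[S] N.carrier
  deg a :=
    { carrier := {φ | ∀ (c : A) (x : F.carrier), x ∈ F.deg c → φ x ∈ N.deg (a + c)}
      add_mem' := fun hf hg c x hx => add_mem (hf c x hx) (hg c x hx)
      zero_mem' := fun _ _ _ => zero_mem _
      neg_mem' := fun hf c x hx => neg_mem (hf c x hx) }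
  isInternal := by
    classical
    obtain ⟨n, b, d, hb⟩ := hF
    refine isInternal_of_sum _ ?_ ?_
    · intro φ
      choose s hs using fun j => N.exists_sum_proj (φ (b j))
      let t : Finset A := Finset.univ.biUnion fun j => (s j).image fun a => a - d j
      refine ⟨t, fun a => b.constr S fun j => N.proj (a + d j) (φ (b j)), ?_, ?_⟩
      · intro a c x hx
        have hx' : x = ∑ j, (DirectSum.decompose 𝒜 (b.repr x j) (c - d j) : S) • b j := by
          conv_lhs => rw [← F.proj_same hx, ← b.sum_repr x, map_sum]
          exact Finset.sum_congr rfl fun j _ => F.proj_smul _ (hb j) c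
        rw [hx', map_sum]
        refine sum_mem fun j _ => ?_
        rw [map_smul, Module.Basis.constr_basis]
        have := N.smul_mem (SetLike.coe_mem (DirectSum.decompose 𝒜 (b.repr x j) (c - d j)))
          (N.proj_mem (a + d j) (φ (b j)))
        rwa [show c - d j + (a + d j) = a + c by abel] at this
      · refine b.ext fun j => ?_
        rw [LinearMap.sum_apply]
        simp only [Module.Basis.constr_basis]
        have h : s j ⊆ t.image fun a => a + d j := by
          intro e he
          refine Finset.mem_image.2 ⟨e - d j, Finset.mem_biUnion.2 ⟨j, Finset.mem_univ _, ?_⟩, by abel⟩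
          exact Finset.mem_image_of_mem _ he
        have h' := hs j _ h
        rwa [Finset.sum_image (fun x _ y _ hxy => add_right_cancel hxy)] at h'
    · intro s f hf h a ha
      refine b.ext fun j => ?_
      have h1 : ∑ e ∈ s.image (fun a => a + d j), f (e - d j) (b j) = 0 := by
        rw [Finset.sum_image (fun x _ y _ hxy => add_right_cancel hxy)]
        simpa using LinearMap.congr_fun h (b j)
      have h2 := N.proj_sum (s := s.image fun a => a + d j) (f := fun e => f (e - d j) (b j))
        (fun e => by simpa using hf (e - d j) (d j) (b j) (hb j))
        (Finset.mem_image_of_mem (fun a => a + d j) ha)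
      rw [h1, map_zero] at h2
      simpa using h2.symm
  smul_mem := by
    intro a c s φ hs hφ e x hx
    have := N.smul_mem hs (hφ e x hx)
    rwa [← add_assoc] at this

/-- Precomposition with a homomorphism of graded modules, `Hom_S(G, N) → Hom_S(F, N)`. -/
def Hom.precomp {F G : GrMod 𝒜} (f : F.Hom G) (N : GrMod 𝒜) (hF : F.IsGrFree)
    (hG : G.IsGrFree) : (G.homGr N hG).Hom (F.homGr N hF) where
  toLin := LinearMap.lcomp S N.carrier f.toLin
  map_deg := fun hφ c x hx => hφ c (f.toLin x) (f.map_deg hx)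

theorem Hom.isHomog_range {M N : GrMod 𝒜} (f : M.Hom N) :
    N.IsHomog (LinearMap.range f.toLin) := by
  rintro _ ⟨z, rfl⟩ a
  exact ⟨M.proj a z, (f.proj_comm a z).symm⟩

theorem isHomog_bot (M : GrMod 𝒜) : M.IsHomog ⊥ := by
  intro z hz a
  rw [Submodule.mem_bot] at hz ⊢
  rw [hz, map_zero]

end GrMod

/-- A free graded `S`-complex `F_0 ← F_1 ← F_2 ← ⋯`: all `F_i` are finitely generated graded free
modules and all differentials are homogeneous of degree `0`. -/
structure FreeComplex (𝒜 : A → Submodule k S) [GradedAlgebra 𝒜] where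
  X : ℕ → GrMod 𝒜
  free : ∀ i, (X i).IsGrFree
  d : ∀ i, (X (i + 1)).Hom (X i)
  d_comp_d : ∀ i, (d i).toLin ∘ₗ (d (i + 1)).toLin = 0

namespace FreeComplex

variable {𝒜 : A → Submodule k S} [GradedAlgebra 𝒜]

/-- The coboundary map `Hom_S(F_i, N) → Hom_S(F_{i+1}, N)` of the complex `Hom_S(F, N)`. -/
def coboundary (F : FreeComplex 𝒜) (N : GrMod 𝒜) (i : ℕ) :
    ((F.X i).homGr N (F.free i)).Hom ((F.X (i + 1)).homGr N (F.free (i + 1))) :=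
  (F.d i).precomp N _ _

/-- The image of `Hom_S(F_{i-1}, N) → Hom_S(F_i, N)`, which is zero for `i = 0`. -/
def coboundaries (F : FreeComplex 𝒜) (N : GrMod 𝒜) :
    ∀ i, Submodule S ((F.X i).homGr N (F.free i)).carrier
  | 0 => ⊥
  | i + 1 => LinearMap.range (F.coboundary N i).toLin

theorem isHomog_coboundaries (F : FreeComplex 𝒜) (N : GrMod 𝒜) :
    ∀ i, ((F.X i).homGr N (F.free i)).IsHomog (F.coboundaries N i)
  | 0 => GrMod.isHomog_bot _
  | i + 1 => (F.coboundary N i).isHomog_range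

/-- The graded `S`-module `H^i(Hom_S(F, N))`. -/
def homCohomology (F : FreeComplex 𝒜) (N : GrMod 𝒜) (i : ℕ) : GrMod 𝒜 :=
  ((F.X i).homGr N (F.free i)).subquotient (LinearMap.ker (F.coboundary N i).toLin)
    (F.coboundaries N i) (F.coboundary N i).isHomog_ker (F.isHomog_coboundaries N i)

/-- The complex has length at most `l`, i.e. `F_i = 0` for `i > l`. -/
def LengthLE (F : FreeComplex 𝒜) (l : ℕ) : Prop :=
  ∀ i, l < i → Subsingleton (F.X i).carrier

end FreeComplex

/-! ### The graded module `Ext` -/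

namespace GrMod

variable (𝒜 : A → Submodule k S) [GradedAlgebra 𝒜]

/-- The graded free module `⨁_j S(-d j)`. -/
def free {n : ℕ} (d : Fin n → A) : GrMod 𝒜 where
  carrier := Fin n → S
  deg a :=
    { carrier := {v | ∀ j, v j ∈ 𝒜 (a - d j)}
      add_mem' := fun hv hw j => add_mem (hv j) (hw j)
      zero_mem' := fun _ => zero_mem _
      neg_mem' := fun hv j => neg_mem (hv j) }
  isInternal := by
    classical
    refine isInternal_of_sum _ ?_ ?_
    · intro v
      choose s hs using fun j => exists_sum_decompose (𝒜 := 𝒜) (v j)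
      refine ⟨Finset.univ.biUnion fun j => (s j).image fun a => a + d j,
        fun a j => (DirectSum.decompose 𝒜 (v j) (a - d j) : S), fun a j => SetLike.coe_mem _, ?_⟩
      funext j
      rw [Finset.sum_apply]
      have h : s j ⊆ (Finset.univ.biUnion fun j => (s j).image fun a => a + d j).image
          fun a => a - d j := by
        intro e he
        refine Finset.mem_image.2 ⟨e + d j, Finset.mem_biUnion.2 ⟨j, Finset.mem_univ _, ?_⟩, by abel⟩
        exact Finset.mem_image_of_mem _ he
      have h' := hs j _ h
      rwa [Finset.sum_image (fun x _ y _ hxy => sub_left_injective hxy)] at h'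
    · intro s f hf h a ha
      funext j
      have h0 : ∑ b ∈ s, f b j = 0 := by simpa using congrFun h j
      have h1 := congrArg (GradedRing.proj 𝒜 (a - d j)) h0
      rw [map_sum, map_zero, Finset.sum_eq_single_of_mem a ha] at h1
      · rw [GradedRing.proj_apply, DirectSum.decompose_of_mem_same 𝒜 (hf a j)] at h1
        exact h1
      · intro b _ hb
        rw [GradedRing.proj_apply]
        exact DirectSum.decompose_of_mem_ne 𝒜 (hf b j) fun h => hb (sub_left_injective h)
  smul_mem := by
    intro a b s v hs hv j
    have := SetLike.mul_mem_graded hs (hv j)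
    rwa [← add_sub_assoc] at this

theorem free_isGrFree {n : ℕ} (d : Fin n → A) : (free 𝒜 d).IsGrFree := by
  refine ⟨n, Pi.basisFun S (Fin n), d, fun j i => ?_⟩
  have h0 : Pi.basisFun S (Fin n) j i = (Pi.single j 1 : Fin n → S) i := by
    rw [Pi.basisFun_apply]
  refine (congrArg (· ∈ 𝒜 (d j - d i)) h0).mpr ?_
  by_cases h : i = j
  · subst h
    rw [Pi.single_eq_same, sub_self]
    exact SetLike.one_mem_graded 𝒜
  · rw [Pi.single_eq_of_ne h]
    exact zero_mem _

variable {𝒜}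

/-- A finitely generated graded module is generated by finitely many homogeneous elements. -/
theorem exists_generators (M : GrMod 𝒜) (hM : Module.Finite S M.carrier) :
    ∃ (n : ℕ) (g : Fin n → M.carrier) (d : Fin n → A), (∀ j, g j ∈ M.deg (d j)) ∧
      Submodule.span S (Set.range g) = ⊤ := by
  classical
  obtain ⟨s, hs⟩ := hM.fg_top
  choose t ht using fun m => M.exists_sum_proj m
  let T : Finset (M.carrier × A) := s.biUnion fun m => (t m).image fun a => (M.proj a m, a)
  let e := T.equivFin.symm
  have hT : ∀ p ∈ T, p.1 ∈ M.deg p.2 := by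
    intro p hp
    obtain ⟨m, _, hp⟩ := Finset.mem_biUnion.1 hp
    obtain ⟨a, _, rfl⟩ := Finset.mem_image.1 hp
    exact M.proj_mem a m
  refine ⟨T.card, fun j => (e j).1.1, fun j => (e j).1.2, fun j => hT _ (e j).2, ?_⟩
  rw [eq_top_iff, ← hs, Submodule.span_le]
  intro m hm
  rw [SetLike.mem_coe, ← ht m _ subset_rfl]
  refine sum_mem fun a ha => Submodule.subset_span ?_
  have hp : (M.proj a m, a) ∈ T :=
    Finset.mem_biUnion.2 ⟨m, hm, Finset.mem_image_of_mem _ ha⟩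
  exact ⟨e.symm ⟨_, hp⟩, by simp⟩

/-- A finitely generated graded free module that surjects onto the finitely generated graded
module `M`: it has one generator for each member of a finite system of homogeneous generators. -/
def cover (M : GrMod 𝒜) (hM : Module.Finite S M.carrier) : GrMod 𝒜 :=
  free 𝒜 (M.exists_generators hM).choose_spec.choose_spec.choose

/-- The surjection from the graded free cover. -/
def coverMap (M : GrMod 𝒜) (hM : Module.Finite S M.carrier) : (M.cover hM).Hom M where
  toLin := Fintype.linearCombination S (M.exists_generators hM).choose_spec.choose
  map_deg := by
    intro a v hv
    refine (congrArg (· ∈ M.deg a) (Fintype.linearCombination_apply S _ v)).mpr ?_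
    refine sum_mem fun j _ => ?_
    have := M.smul_mem (hv j) ((M.exists_generators hM).choose_spec.choose_spec.choose_spec.1 j)
    rwa [sub_add_cancel] at this

theorem coverMap_surjective (M : GrMod 𝒜) (hM : Module.Finite S M.carrier) :
    Function.Surjective (M.coverMap hM).toLin := by
  rw [← LinearMap.range_eq_top]
  exact (Fintype.range_linearCombination S _).trans
    (M.exists_generators hM).choose_spec.choose_spec.choose_spec.2

variable [IsNoetherianRing S]

/-- The kernel of the graded free cover, a first syzygy module of `M`. -/
def kerCover (M : GrMod 𝒜) (hM : Module.Finite S M.carrier) : GrMod 𝒜 :=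
  (M.cover hM).ofSubmodule (LinearMap.ker (M.coverMap hM).toLin) (M.coverMap hM).isHomog_ker

theorem kerCover_finite (M : GrMod 𝒜) (hM : Module.Finite S M.carrier) :
    Module.Finite S (M.kerCover hM).carrier :=
  inferInstanceAs (Module.Finite S
    (LinearMap.ker (Fintype.linearCombination S (M.exists_generators hM).choose_spec.choose)))

/-- The inclusion of the syzygy module. -/
def kerCoverIncl (M : GrMod 𝒜) (hM : Module.Finite S M.carrier) :
    (M.kerCover hM).Hom (M.cover hM) where
  toLin := (LinearMap.ker (M.coverMap hM).toLin).subtype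
  map_deg := fun h => h

/-- The iterated syzygy modules of `M`. -/
def syzygy (M : GrMod 𝒜) (hM : Module.Finite S M.carrier) :
    ℕ → {K : GrMod 𝒜 // Module.Finite S K.carrier}
  | 0 => ⟨M, hM⟩
  | i + 1 => ⟨(syzygy M hM i).1.kerCover (syzygy M hM i).2,
      (syzygy M hM i).1.kerCover_finite (syzygy M hM i).2⟩

/-- The graded free cover `F_i` of the `i`-th syzygy module. -/
def syzygyCover (M : GrMod 𝒜) (hM : Module.Finite S M.carrier) (i : ℕ) : GrMod 𝒜 :=
  (M.syzygy hM i).1.cover (M.syzygy hM i).2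

/-- The surjection from `F_i` onto the `i`-th syzygy module. -/
def syzygyCoverMap (M : GrMod 𝒜) (hM : Module.Finite S M.carrier) (i : ℕ) :
    (M.syzygyCover hM i).Hom (M.syzygy hM i).1 :=
  (M.syzygy hM i).1.coverMap (M.syzygy hM i).2

/-- The inclusion of the `(i + 1)`-st syzygy module into `F_i`. -/
def syzygyIncl (M : GrMod 𝒜) (hM : Module.Finite S M.carrier) (i : ℕ) :
    (M.syzygy hM (i + 1)).1.Hom (M.syzygyCover hM i) :=
  (M.syzygy hM i).1.kerCoverIncl (M.syzygy hM i).2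

theorem syzygyCoverMap_surjective (M : GrMod 𝒜) (hM : Module.Finite S M.carrier) (i : ℕ) :
    Function.Surjective (M.syzygyCoverMap hM i).toLin :=
  coverMap_surjective _ _

theorem syzygyIncl_injective (M : GrMod 𝒜) (hM : Module.Finite S M.carrier) (i : ℕ) :
    Function.Injective (M.syzygyIncl hM i).toLin :=
  Subtype.val_injective

theorem syzygy_exact (M : GrMod 𝒜) (hM : Module.Finite S M.carrier) (i : ℕ) :
    Function.Exact (M.syzygyIncl hM i).toLin (M.syzygyCoverMap hM i).toLin := fun y =>
  ⟨fun h => ⟨⟨y, h⟩, rfl⟩, fun ⟨x, hx⟩ => hx ▸ x.2⟩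

/-- A graded free resolution of the finitely generated graded module `M`, obtained by covering
`M` and its successive syzygy modules by finitely generated graded free modules. -/
def freeResolution (M : GrMod 𝒜) (hM : Module.Finite S M.carrier) : FreeComplex 𝒜 where
  X i := M.syzygyCover hM i
  free i := free_isGrFree 𝒜 _
  d i := (M.syzygyIncl hM i).comp (M.syzygyCoverMap hM (i + 1))
  d_comp_d i := by
    ext1 x
    have h := (M.syzygy_exact hM (i + 1)).apply_apply_eq_zero
      ((M.syzygyCoverMap hM (i + 2)).toLin x)
    change (M.syzygyIncl hM i).toLin ((M.syzygyCoverMap hM (i + 1)).toLin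
      ((M.syzygyIncl hM (i + 1)).toLin ((M.syzygyCoverMap hM (i + 2)).toLin x))) = 0
    rw [h, map_zero]

/-- The complex `freeResolution M` is exact in positive degrees. -/
theorem freeResolution_exact (M : GrMod 𝒜) (hM : Module.Finite S M.carrier) (i : ℕ) :
    Function.Exact ((M.freeResolution hM).d (i + 1)).toLin ((M.freeResolution hM).d i).toLin := by
  intro y
  constructor
  · intro h
    have h1 : (M.syzygyCoverMap hM (i + 1)).toLin y = 0 :=
      M.syzygyIncl_injective hM i (h.trans (map_zero _).symm)
    obtain ⟨z, rfl⟩ := (M.syzygy_exact hM (i + 1) y).1 h1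
    obtain ⟨x, rfl⟩ := M.syzygyCoverMap_surjective hM (i + 2) z
    exact ⟨x, rfl⟩
  · rintro ⟨x, rfl⟩
    exact LinearMap.congr_fun ((M.freeResolution hM).d_comp_d i) x

/-- The augmentation `F_0 → M` of `freeResolution M`. -/
def freeResolutionAug (M : GrMod 𝒜) (hM : Module.Finite S M.carrier) :
    ((M.freeResolution hM).X 0).Hom M :=
  M.syzygyCoverMap hM 0

theorem freeResolutionAug_surjective (M : GrMod 𝒜) (hM : Module.Finite S M.carrier) :
    Function.Surjective (M.freeResolutionAug hM).toLin :=
  M.syzygyCoverMap_surjective hM 0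

/-- The kernel of the augmentation is the image of `F_1 → F_0`. -/
theorem freeResolutionAug_exact (M : GrMod 𝒜) (hM : Module.Finite S M.carrier) :
    Function.Exact ((M.freeResolution hM).d 0).toLin (M.freeResolutionAug hM).toLin := by
  intro y
  constructor
  · intro h
    obtain ⟨z, rfl⟩ := (M.syzygy_exact hM 0 y).1 h
    obtain ⟨x, rfl⟩ := M.syzygyCoverMap_surjective hM 1 z
    exact ⟨x, rfl⟩
  · rintro ⟨x, rfl⟩
    exact (M.syzygy_exact hM 0).apply_apply_eq_zero ((M.syzygyCoverMap hM 1).toLin x)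

/-- The graded `S`-module `Ext^i_S(M, N)`, for a finitely generated graded module `M`: the `i`-th
cohomology of `Hom_S(G, N)` for a graded free resolution `G` of `M`. -/
def gradedExt (M N : GrMod 𝒜) [hM : Module.Finite S M.carrier] (i : ℕ) : GrMod 𝒜 :=
  (M.freeResolution hM).homCohomology N i

end GrMod

/-! ### The multigraded homogeneous spectrum and the sheaves `M^~` -/

variable (𝒜 : A → Submodule k S) (B : Ideal S)

section Sheaves

variable [GradedAlgebra 𝒜]

/-- The homogeneous prime ideals of `S` that do not contain the ideal `B`, with the Zariski
topology. -/
def RelSpec : Type u :=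
  {P : PrimeSpectrum S // P.asIdeal.IsHomogeneous 𝒜 ∧ ¬ B ≤ P.asIdeal}

instance : TopologicalSpace (RelSpec 𝒜 B) :=
  instTopologicalSpaceSubtype (p := fun P : PrimeSpectrum S =>
    P.asIdeal.IsHomogeneous 𝒜 ∧ ¬ B ≤ P.asIdeal)

/-- `RelSpec` as an object of the category of topological spaces. -/
abbrev RelSpec.top : TopCat.{u} := TopCat.of (RelSpec 𝒜 B)

variable {𝒜 B}

/-- The prime ideal belonging to a point. -/
def RelSpec.ideal (P : RelSpec 𝒜 B) : Ideal S := P.1.asIdeal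

instance (P : RelSpec 𝒜 B) : P.ideal.IsPrime := P.1.isPrime

/-- The localization of an `S`-module at the prime ideal `P`. -/
abbrev RelSpec.Loc (P : RelSpec 𝒜 B) (M : Type u) [AddCommGroup M] [Module S M] : Type u :=
  LocalizedModule P.ideal.primeCompl M

/-- A family of germs `f x ∈ M_x` is a homogeneous fraction of degree `0` on `U` if it is of the
form `m / s` with `m ∈ M` and `s ∈ S` homogeneous of the same degree and `s` outside of all the
primes in `U`. -/
def IsHomFraction {M : Type u} [AddCommGroup M] [Module S M] (deg : A → AddSubgroup M)
    {U : Opens (RelSpec 𝒜 B)} (f : ∀ x : U, x.1.Loc M) : Prop :=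
  ∃ a : A, ∃ m ∈ deg a, ∃ s ∈ 𝒜 a, ∀ x : U, ∃ hs : s ∈ x.1.ideal.primeCompl,
    f x = LocalizedModule.mk m ⟨s, hs⟩

/-- Being locally a homogeneous fraction of degree `0`. -/
def IsLocHomFraction {M : Type u} [AddCommGroup M] [Module S M] (deg : A → AddSubgroup M)
    {U : Opens (RelSpec 𝒜 B)} (f : ∀ x : U, x.1.Loc M) : Prop :=
  ∀ x : U, ∃ (V : Opens (RelSpec 𝒜 B)) (_ : x.1 ∈ V) (i : V ≤ U),
    IsHomFraction deg fun y : V => f ⟨y.1, i y.2⟩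

/-- The degree components of `S` as additive subgroups. -/
def ringDeg (𝒜 : A → Submodule k S) (a : A) : AddSubgroup S := (𝒜 a).toAddSubgroup

theorem ringDeg_mul {a b : A} {s t : S} (hs : s ∈ 𝒜 a) (ht : t ∈ 𝒜 b) :
    s * t ∈ ringDeg 𝒜 (a + b) :=
  SetLike.mul_mem_graded (A := 𝒜) hs ht

/-- The ring `Γ(U, 𝒪)` of functions on `U` that are locally homogeneous fractions of degree `0`. -/
def ringSections (U : Opens (RelSpec 𝒜 B)) : Subring (∀ x : U, x.1.Loc S) where
  carrier := {f | IsLocHomFraction (ringDeg 𝒜) f}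
  zero_mem' x := ⟨U, x.2, le_rfl, 0, 0, zero_mem _, 1, SetLike.one_mem_graded 𝒜, fun y =>
    ⟨one_mem _, (LocalizedModule.zero_mk _).symm⟩⟩
  one_mem' x := ⟨U, x.2, le_rfl, 0, 1, SetLike.one_mem_graded 𝒜, 1, SetLike.one_mem_graded 𝒜,
    fun y => ⟨one_mem _, OreLocalization.one_def⟩⟩
  add_mem' {f g} hf hg x := by
    obtain ⟨V, hV, iV, a, m, hm, s, hs, h⟩ := hf x
    obtain ⟨W, hW, iW, b, n, hn, t, ht, h'⟩ := hg x
    refine ⟨V ⊓ W, ⟨hV, hW⟩, inf_le_left.trans iV, a + b, t • m + s • n, ?_, s * t,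
      SetLike.mul_mem_graded hs ht, fun y => ?_⟩
    · refine add_mem ?_ (ringDeg_mul hs hn)
      rw [add_comm a b]
      exact ringDeg_mul ht hm
    · obtain ⟨h1, h2⟩ := h ⟨y.1, y.2.1⟩
      obtain ⟨h3, h4⟩ := h' ⟨y.1, y.2.2⟩
      exact ⟨mul_mem h1 h3, (congrArg₂ (· + ·) h2 h4).trans LocalizedModule.mk_add_mk⟩
  neg_mem' {f} hf x := by
    obtain ⟨V, hV, iV, a, m, hm, s, hs, h⟩ := hf x
    refine ⟨V, hV, iV, a, -m, neg_mem hm, s, hs, fun y => ?_⟩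
    obtain ⟨h1, h2⟩ := h y
    exact ⟨h1, (congrArg (- ·) h2).trans LocalizedModule.mk_neg.symm⟩
  mul_mem' {f g} hf hg x := by
    obtain ⟨V, hV, iV, a, m, hm, s, hs, h⟩ := hf x
    obtain ⟨W, hW, iW, b, n, hn, t, ht, h'⟩ := hg x
    refine ⟨V ⊓ W, ⟨hV, hW⟩, inf_le_left.trans iV, a + b, m * n, ringDeg_mul hm hn,
      s * t, SetLike.mul_mem_graded hs ht, fun y => ?_⟩
    obtain ⟨h1, h2⟩ := h ⟨y.1, y.2.1⟩
    obtain ⟨h3, h4⟩ := h' ⟨y.1, y.2.2⟩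
    exact ⟨mul_mem h1 h3, (congrArg₂ (· * ·) h2 h4).trans LocalizedModule.mk_mul_mk⟩

/-- The group `Γ(U, M^~)` of families of germs on `U` that are locally homogeneous fractions of
degree `0`. -/
def modSections (M : GrMod 𝒜) (U : Opens (RelSpec 𝒜 B)) :
    Submodule (ringSections U) (∀ x : U, x.1.Loc M.carrier) where
  carrier := {f | IsLocHomFraction M.deg f}
  zero_mem' x := ⟨U, x.2, le_rfl, 0, 0, zero_mem _, 1, SetLike.one_mem_graded 𝒜, fun y =>
    ⟨one_mem _, (LocalizedModule.zero_mk _).symm⟩⟩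
  add_mem' {f g} hf hg x := by
    obtain ⟨V, hV, iV, a, m, hm, s, hs, h⟩ := hf x
    obtain ⟨W, hW, iW, b, n, hn, t, ht, h'⟩ := hg x
    refine ⟨V ⊓ W, ⟨hV, hW⟩, inf_le_left.trans iV, a + b, t • m + s • n, ?_, s * t,
      SetLike.mul_mem_graded hs ht, fun y => ?_⟩
    · refine add_mem ?_ (M.smul_mem hs hn)
      rw [add_comm a b]
      exact M.smul_mem ht hm
    · obtain ⟨h1, h2⟩ := h ⟨y.1, y.2.1⟩
      obtain ⟨h3, h4⟩ := h' ⟨y.1, y.2.2⟩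
      exact ⟨mul_mem h1 h3, (congrArg₂ (· + ·) h2 h4).trans LocalizedModule.mk_add_mk⟩
  smul_mem' r f hf x := by
    obtain ⟨V, hV, iV, a, m, hm, s, hs, h⟩ := (show IsLocHomFraction (ringDeg 𝒜) r.1 from r.2) x
    obtain ⟨W, hW, iW, b, n, hn, t, ht, h'⟩ := hf x
    refine ⟨V ⊓ W, ⟨hV, hW⟩, inf_le_left.trans iV, a + b, m • n, M.smul_mem hm hn,
      s * t, SetLike.mul_mem_graded hs ht, fun y => ?_⟩
    obtain ⟨h1, h2⟩ := h ⟨y.1, y.2.1⟩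
    obtain ⟨h3, h4⟩ := h' ⟨y.1, y.2.2⟩
    exact ⟨mul_mem h1 h3, (congrArg₂ (· • ·) h2 h4).trans (LocalizedModule.mk_smul_mk _ _ _ _)⟩

/-- The type of functions on `U`. -/
def RingSec (U : Opens (RelSpec 𝒜 B)) : Type u := ringSections U

/-- The type of sections of `M^~` on `U`. -/
def ModSec (M : GrMod 𝒜) (U : Opens (RelSpec 𝒜 B)) : Type u := modSections M U

instance (U : Opens (RelSpec 𝒜 B)) : CommRing (RingSec U) :=
  inferInstanceAs (CommRing (ringSections U))

instance (M : GrMod 𝒜) (U : Opens (RelSpec 𝒜 B)) : AddCommGroup (ModSec M U) :=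
  (modSections M U).addCommGroup

instance (M : GrMod 𝒜) (U : Opens (RelSpec 𝒜 B)) : Module (RingSec U) (ModSec M U) :=
  (modSections M U).module

theorem IsLocHomFraction.res {M : Type u} [AddCommGroup M] [Module S M] {deg : A → AddSubgroup M}
    {U V : Opens (RelSpec 𝒜 B)} (i : V ≤ U) {f : ∀ x : U, x.1.Loc M}
    (hf : IsLocHomFraction deg f) :
    IsLocHomFraction deg (U := V) fun x => f ⟨x.1, i x.2⟩ := fun x => by
  obtain ⟨W, hW, iW, a, m, hm, s, hs, h⟩ := hf ⟨x.1, i x.2⟩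
  exact ⟨V ⊓ W, ⟨x.2, hW⟩, inf_le_left, a, m, hm, s, hs, fun y => h ⟨y.1, y.2.2⟩⟩

/-- Restriction of functions. -/
def ringRes {U V : Opens (RelSpec 𝒜 B)} (i : V ≤ U) : RingSec U →+* RingSec V where
  toFun f := ⟨fun x => f.1 ⟨x.1, i x.2⟩, IsLocHomFraction.res i f.2⟩
  map_one' := rfl
  map_mul' _ _ := rfl
  map_zero' := rfl
  map_add' _ _ := rfl

/-- Restriction of sections. -/
def modRes (M : GrMod 𝒜) {U V : Opens (RelSpec 𝒜 B)} (i : V ≤ U) :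
    ModSec M U →+ ModSec M V where
  toFun f := ⟨fun x => f.1 ⟨x.1, i x.2⟩, IsLocHomFraction.res i f.2⟩
  map_zero' := rfl
  map_add' _ _ := rfl

theorem modRes_smul (M : GrMod 𝒜) {U V : Opens (RelSpec 𝒜 B)} (i : V ≤ U) (r : RingSec U)
    (m : ModSec M U) : modRes M i (r • m) = ringRes i r • modRes M i m := rfl

variable (𝒜 B) in
/-- The structure presheaf. -/
def ringPresheaf : (Opens (RelSpec.top 𝒜 B))ᵒᵖ ⥤ RingCat.{u} where
  obj U := RingCat.of (RingSec (𝒜 := 𝒜) (B := B) U.unop)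
  map i := RingCat.ofHom (ringRes i.unop.le)
  map_id _ := rfl
  map_comp _ _ := rfl

/-- The presheaf of abelian groups underlying `M^~`. -/
def abPresheaf (M : GrMod 𝒜) : (Opens (RelSpec.top 𝒜 B))ᵒᵖ ⥤ Ab.{u} where
  obj U := AddCommGrpCat.of (ModSec (B := B) M U.unop)
  map i := AddCommGrpCat.ofHom (modRes M i.unop.le)
  map_id _ := rfl
  map_comp _ _ := rfl

instance (M : GrMod 𝒜) (U : (Opens (RelSpec.top 𝒜 B))ᵒᵖ) :
    Module ((ringPresheaf 𝒜 B).obj U) ((abPresheaf (B := B) M).obj U) :=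
  inferInstanceAs (Module (RingSec (𝒜 := 𝒜) (B := B) U.unop) (ModSec (B := B) M U.unop))

/-- The presheaf of modules `M^~`. -/
def modPresheaf (M : GrMod 𝒜) : PresheafOfModules.{u} (ringPresheaf 𝒜 B) :=
  .ofPresheaf (abPresheaf M) fun _ _ i r m => modRes_smul M i.unop.le r m

variable (𝒜 B) in
/-- Being locally a homogeneous fraction of degree `0`, as a local predicate. -/
def locHomFraction {M : Type u} [AddCommGroup M] [Module S M] (deg : A → AddSubgroup M) :
    TopCat.LocalPredicate (X := RelSpec.top 𝒜 B) (fun x => RelSpec.Loc (𝒜 := 𝒜) (B := B) x M) where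
  pred {U} f := IsLocHomFraction (U := U) deg f
  res i _ hf := hf.res i.le
  locality {U} f hf x := by
    obtain ⟨V, hV, i, h⟩ := hf x
    obtain ⟨W, hW, iW, h'⟩ := h ⟨x.1, hV⟩
    exact ⟨W, hW, iW.trans i.le, h'⟩

theorem ringPresheaf_isSheaf : TopCat.Presheaf.IsSheaf (ringPresheaf 𝒜 B) :=
  (TopCat.Presheaf.isSheaf_iff_isSheaf_comp (forget RingCat) _).2
    (TopCat.subsheafToTypes (locHomFraction 𝒜 B (ringDeg 𝒜))).2

theorem abPresheaf_isSheaf (M : GrMod 𝒜) : TopCat.Presheaf.IsSheaf (abPresheaf (B := B) M) :=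
  (TopCat.Presheaf.isSheaf_iff_isSheaf_comp (forget Ab) _).2
    (TopCat.subsheafToTypes (locHomFraction 𝒜 B M.deg)).2

variable (𝒜 B) in
/-- The structure sheaf `𝒪`. -/
def structureSheaf : Sheaf (Opens.grothendieckTopology (RelSpec.top 𝒜 B)) RingCat.{u} :=
  ⟨ringPresheaf 𝒜 B, ringPresheaf_isSheaf⟩

variable (B) in
/-- The sheaf of `𝒪`-modules `M^~`. -/
def tilde (M : GrMod 𝒜) : SheafOfModules.{u} (structureSheaf 𝒜 B) where
  val := modPresheaf M
  isSheaf := abPresheaf_isSheaf M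

/-- The action of a graded homomorphism on sections. -/
def tildeMapSections {M N : GrMod 𝒜} (f : M.Hom N) (U : Opens (RelSpec 𝒜 B)) :
    ModSec M U →ₗ[RingSec U] ModSec N U where
  toFun s := ⟨fun x => LocalizedModule.map x.1.ideal.primeCompl f.toLin (s.1 x), fun x => by
    obtain ⟨V, hV, i, a, m, hm, t, ht, h⟩ := (show IsLocHomFraction M.deg s.1 from s.2) x
    refine ⟨V, hV, i, a, f.toLin m, f.map_deg hm, t, ht, fun y => ?_⟩
    obtain ⟨h1, h2⟩ := h y
    exact ⟨h1, (congrArg _ h2).trans (LocalizedModule.map_mk _ _ _ _)⟩⟩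
  map_add' s t := Subtype.ext <| funext fun x => map_add _ _ _
  map_smul' r s := Subtype.ext <| funext fun x => map_smul _ (r.1 x) _

variable (B) in
/-- The morphism of sheaves of `𝒪`-modules `M^~ → N^~` induced by a graded homomorphism. -/
def tildeMap {M N : GrMod 𝒜} (f : M.Hom N) : tilde B M ⟶ tilde B N where
  val := PresheafOfModules.homMk
    { app := fun U => AddCommGrpCat.ofHom (tildeMapSections f U.unop).toAddMonoidHom
      naturality := fun _ _ _ => rfl } fun U r m => (tildeMapSections f U.unop).map_smul r m

end Sheaves

/-! ### Virtual resolutions -/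

/-- A morphism of sheaves of modules on a topological space is surjective (as a morphism of
sheaves): every section of the target lifts locally. -/
def SheafSurjective {T : TopCat.{u}} {R : Sheaf (Opens.grothendieckTopology T) RingCat.{u}}
    {P Q : SheafOfModules.{u} R} (φ : P ⟶ Q) : Prop :=
  ∀ (U : Opens T) (t : Q.val.presheaf.obj (op U)), ∀ x ∈ U,
    ∃ (V : Opens T) (_ : x ∈ V) (i : V ⟶ U) (s : P.val.presheaf.obj (op V)),
      φ.val.app (op V) s = Q.val.presheaf.map i.op t

/-- Exactness of `P ⟶ Q ⟶ L` as a sequence of sheaves of modules on a topological space: the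
composition is zero, and every section of `Q` that is killed by `ψ` lifts locally to `P`. -/
def SheafExact {T : TopCat.{u}} {R : Sheaf (Opens.grothendieckTopology T) RingCat.{u}}
    {P Q L : SheafOfModules.{u} R} (φ : P ⟶ Q) (ψ : Q ⟶ L) : Prop :=
  φ ≫ ψ = 0 ∧ ∀ (U : Opens T) (t : Q.val.presheaf.obj (op U)), ψ.val.app (op U) t = 0 →
    ∀ x ∈ U, ∃ (V : Opens T) (_ : x ∈ V) (i : V ⟶ U) (s : P.val.presheaf.obj (op V)),
      φ.val.app (op V) s = Q.val.presheaf.map i.op t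

/-- The free graded complex `F` is a virtual resolution of `M`: for a suitable morphism of
sheaves `F_0^~ → M^~`, the sequence `0 ← M^~ ← F_0^~ ← F_1^~ ← ⋯` of sheaves is exact. -/
def IsVirtualResolution {𝒜 : A → Submodule k S} [GradedAlgebra 𝒜] (B : Ideal S)
    (F : FreeComplex 𝒜) (M : GrMod 𝒜) : Prop :=
  ∃ ε : tilde B (F.X 0) ⟶ tilde B M, SheafSurjective ε ∧
    SheafExact (tildeMap B (F.d 0)) ε ∧
    ∀ i, SheafExact (tildeMap B (F.d (i + 1))) (tildeMap B (F.d i))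

end GradedModules

/-! ### Smooth projective toric varieties and their Cox rings -/

/-- The cone in `ℝ^n` generated by the vectors `ray i` with `i ∈ σ`. -/
def coneSpan {n : ℕ} {ι : Type} [Fintype ι] (ray : ι → Fin n → ℤ) (σ : Finset ι) :
    Set (Fin n → ℝ) :=
  {v | ∃ c : ι → ℝ, (∀ i, 0 ≤ c i) ∧ (∀ i, i ∉ σ → c i = 0) ∧
    v = ∑ i, c i • fun j => (ray i j : ℝ)}

/-- The fan in `ℝ^n`, with respect to the lattice `ℤ^n`, of a smooth projective toric variety of
dimension `n`. It is given by the primitive generators `ray i` of its rays and by the sets of rays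
of its maximal cones. -/
structure SmoothProjectiveFan (n : ℕ) (ι : Type) [Fintype ι] [DecidableEq ι] where
  ray : ι → Fin n → ℤ
  maxCones : Set (Finset ι)
  /-- every ray belongs to a cone -/
  exists_mem : ∀ i, ∃ σ ∈ maxCones, i ∈ σ
  /-- smoothness: the generators of a maximal cone form a basis of the lattice -/
  linearIndependent : ∀ σ ∈ maxCones, LinearIndependent ℤ fun i : σ => ray i
  span_eq_top : ∀ σ ∈ maxCones, Submodule.span ℤ (Set.range fun i : σ => ray i) = ⊤
  /-- two cones meet in the common face that is generated by the common rays -/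
  inter_eq : ∀ σ ∈ maxCones, ∀ τ ∈ maxCones,
    coneSpan ray σ ∩ coneSpan ray τ = coneSpan ray (σ ∩ τ)
  /-- completeness: the cones cover `ℝ^n` -/
  complete : ∀ v : Fin n → ℝ, ∃ σ ∈ maxCones, v ∈ coneSpan ray σ
  /-- projectivity: there is a torus-invariant divisor `∑ a i • D i` whose support function is
  strictly convex, i.e. which is ample -/
  projective : ∃ a : ι → ℤ, ∀ σ ∈ maxCones, ∃ m : Module.Dual ℤ (Fin n → ℤ),
    (∀ i ∈ σ, m (ray i) = -a i) ∧ ∀ i, i ∉ σ → -a i < m (ray i)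

namespace SmoothProjectiveFan

variable {n : ℕ} {ι : Type} [Fintype ι] [DecidableEq ι] (X : SmoothProjectiveFan n ι)

/-- The map that sends a character of the torus to its divisor, `m ↦ (⟨m, ray i⟩)_i`. -/
def divMap : Module.Dual ℤ (Fin n → ℤ) →ₗ[ℤ] (ι → ℤ) :=
  LinearMap.pi fun i => LinearMap.applyₗ (X.ray i)

/-- The Picard group of the toric variety (which equals its class group, by smoothness): the group
of torus-invariant divisors modulo the divisors of characters. -/
abbrev Pic : Type := (ι → ℤ) ⧸ LinearMap.range X.divMap

instance : DecidableEq X.Pic := Classical.decEq _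

/-- The class of the prime divisor that belongs to the ray `i`, which is the degree of the
`i`-th variable of the Cox ring. -/
def rayClass (i : ι) : X.Pic := Submodule.Quotient.mk (Pi.single i 1)

variable (k : Type u) [Field k]

/-- The grading of the Cox ring `k[x_i : i ∈ ι]` by the Picard group. -/
def coxGrading : X.Pic → Submodule k (MvPolynomial ι k) :=
  MvPolynomial.weightedHomogeneousSubmodule k X.rayClass

instance : GradedAlgebra (X.coxGrading k) :=
  MvPolynomial.weightedGradedAlgebra k X.rayClass

/-- The irrelevant ideal of the Cox ring, generated by the monomials `∏_{i ∉ σ} x_i` for the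
maximal cones `σ`. -/
def irrelevantIdeal : Ideal (MvPolynomial ι k) :=
  Ideal.span ((fun σ : Finset ι => ∏ i ∈ σᶜ, MvPolynomial.X i) '' X.maxCones)

/-- The toric variety of the fan over `k`, in Cox's homogeneous coordinates: the points of the
scheme are the `Pic`-homogeneous prime ideals of the Cox ring that do not contain the irrelevant
ideal. Its structure sheaf is `structureSheaf (X.coxGrading k) (X.irrelevantIdeal k)`. The affine
chart of a maximal cone `σ` is the set of points that do not contain `∏_{i ∉ σ} x_i`; there
`tilde` is given by the degree `0` part of the localization of the module at that monomial. -/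
abbrev variety : TopCat.{u} := RelSpec.top (X.coxGrading k) (X.irrelevantIdeal k)

/-- `Pic`-graded modules over the Cox ring. -/
abbrev CoxModule : Type (u + 1) := GrMod (X.coxGrading k)

variable {k}

/-- The sheaf on the toric variety that belongs to a graded module over the Cox ring. -/
abbrev sheaf (M : X.CoxModule k) :
    SheafOfModules.{u} (structureSheaf (X.coxGrading k) (X.irrelevantIdeal k)) :=
  tilde (X.irrelevantIdeal k) M

end SmoothProjectiveFan

end

noncomputable section

variable {A : Type} [AddCommGroup A] [DecidableEq A] {k : Type u} {S : Type u} [CommRing k]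
  [CommRing S] [Algebra k S] {𝒜 : A → Submodule k S} [GradedAlgebra 𝒜] {B : Ideal S}

/-! ### Stalks of morphisms between sheaves of graded modules -/

/-! The sheaf of `H^i(Hom(F, N))` depends only on `M`, not on the chosen virtual resolution. Since
`~` is exact, an honest graded free resolution of `M` is virtual
(`GrMod.freeResolution_isVirtualResolution`), and its cohomology is `Ext` by definition. So it
suffices to compare two virtual resolutions `F` and `G` of `M` (`IsVirtualResolution.nonempty_iso`).

A chain map `G → F` over `M` need not exist globally: exactness holds only for sheaves, and the
augmentations are morphisms of sheaves which need not come from graded modules. Near a point `P`,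
however, the usual comparison argument works up to homogeneous denominators. Smoothness gives, at
each point, a fraction of nonvanishing monomials in every degree (`hasHomogeneousUnits`). A sheaf
morphism, which only sees degree `0`, therefore extends to an `S`-linear map `stalkMap` on elements
of all degrees, and sheaf exactness becomes exactness up to multiplication by a homogeneous `t ∉ P`.
As the free modules have finite bases, lifts over finitely many degrees have a common denominator
(`FractionalChainMap.exists_isLift`), and two lifts are homotopic up to a denominator
(`exists_homotopy`).

Hence the map induced on cohomology, divided by the denominator of the lift, is a well-defined map
of localizations at `P` (`IsLift.pullback_eq`). A lift at `P` is still a lift at nearby points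
(`IsLift.eventually`), so these maps glue to a morphism of sheaves (`StalkFamily.toHom`). Comparing
a composite of lifts with the identity shows that the two directions are mutually inverse. For the
second claim, `Hom(F_i, N)` vanishes beyond the length of `F`. -/

theorem RelSpec.smul_left_cancel (P : RelSpec 𝒜 B) {M : Type u} [AddCommGroup M] [Module S M]
    {s : S} (hs : s ∉ P.ideal) {x y : P.Loc M} (h : s • x = s • y) : x = y :=
  IsLocalizedModule.smul_injective (LocalizedModule.mkLinearMap P.ideal.primeCompl M)
    (⟨s, hs⟩ : P.ideal.primeCompl) h

/-- The canonical map from a module to its localization at a point. -/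
abbrev RelSpec.toLoc (P : RelSpec 𝒜 B) (M : Type u) [AddCommGroup M] [Module S M] :
    M →ₗ[S] P.Loc M :=
  LocalizedModule.mkLinearMap P.ideal.primeCompl M

/-- The fraction `m / r` in the localization at a point. -/
def RelSpec.frac (P : RelSpec 𝒜 B) {M : Type u} [AddCommGroup M] [Module S M] (m : M) {r : S}
    (hr : r ∉ P.ideal) : P.Loc M :=
  LocalizedModule.mk m (⟨r, hr⟩ : P.ideal.primeCompl)

theorem RelSpec.smul_frac (P : RelSpec 𝒜 B) {M : Type u} [AddCommGroup M] [Module S M]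
    (m : M) {r : S} (hr : r ∉ P.ideal) : r • P.frac m hr = P.toLoc M m := by
  unfold RelSpec.frac
  rw [LocalizedModule.smul'_mk, LocalizedModule.mkLinearMap_apply, LocalizedModule.mk_eq]
  exact ⟨1, by simp [Submonoid.smul_def]⟩

/-- Clears the denominator of a scalar from the local ring, so that later computations need only the
action of `S`. -/
theorem RelSpec.smul_frac_smul (P : RelSpec 𝒜 B) {M : Type u} [AddCommGroup M] [Module S M]
    (c : S) {r : S} (hr : r ∉ P.ideal) (x : P.Loc M) :
    r • ((P.frac c hr : P.Loc S) • x) = c • x := by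
  induction x using LocalizedModule.induction_on with
  | h m t =>
    refine (congrArg (r • ·) (LocalizedModule.mk_smul_mk c m ⟨r, hr⟩ t)).trans ?_
    rw [LocalizedModule.smul'_mk, LocalizedModule.smul'_mk, LocalizedModule.mk_eq]
    exact ⟨1, by simp only [Submonoid.smul_def, Submonoid.coe_mul, one_smul, smul_smul]; ring_nf⟩

theorem RelSpec.toLoc_eq_iff (P : RelSpec 𝒜 B) {M : Type u} [AddCommGroup M] [Module S M]
    {m m' : M} : P.toLoc M m = P.toLoc M m' ↔ ∃ t, t ∉ P.ideal ∧ t • m = t • m' := by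
  rw [LocalizedModule.mkLinearMap_apply, LocalizedModule.mkLinearMap_apply, LocalizedModule.mk_eq]
  constructor
  · rintro ⟨t, ht⟩
    exact ⟨t, t.2, by simpa [Submonoid.smul_def] using ht⟩
  · rintro ⟨t, ht, h⟩
    exact ⟨⟨t, ht⟩, by simpa [Submonoid.smul_def] using h⟩

theorem RelSpec.mul_notMem (P : RelSpec 𝒜 B) {s t : S} (hs : s ∉ P.ideal) (ht : t ∉ P.ideal) :
    s * t ∉ P.ideal :=
  P.ideal.primeCompl.mul_mem hs ht

theorem RelSpec.one_notMem (P : RelSpec 𝒜 B) : (1 : S) ∉ P.ideal :=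
  P.ideal.primeCompl.one_mem

/-- The open set of points at which a given element of the ring does not vanish. -/
def RelSpec.basicOpen (s : S) : Opens (RelSpec 𝒜 B) :=
  ⟨{x | s ∉ x.ideal}, (PrimeSpectrum.basicOpen s).2.preimage continuous_subtype_val⟩

theorem RelSpec.notMem_of_mem_basicOpen {s : S} :
    ∀ x ∈ RelSpec.basicOpen (𝒜 := 𝒜) (B := B) s, s ∉ x.ideal :=
  fun _ h => h

/-- The section `m / r` of `M^~`. -/
def fracSec {M : GrMod 𝒜} {a : A} {m : M.carrier} (hm : m ∈ M.deg a) {r : S} (hr : r ∈ 𝒜 a)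
    {U : Opens (RelSpec 𝒜 B)} (hU : ∀ x ∈ U, r ∉ x.ideal) : ModSec M U :=
  ⟨fun x => x.1.frac m (hU x x.2), fun x => ⟨U, x.2, le_rfl, a, m, hm, r, hr,
    fun y => ⟨hU y y.2, rfl⟩⟩⟩

/-- The section `c / r` of the structure sheaf. -/
def fracRing {a : A} {c : S} (hc : c ∈ 𝒜 a) {r : S} (hr : r ∈ 𝒜 a)
    {U : Opens (RelSpec 𝒜 B)} (hU : ∀ x ∈ U, r ∉ x.ideal) : RingSec U :=
  ⟨fun x => x.1.frac c (hU x x.2), fun x => ⟨U, x.2, le_rfl, a, c, hc, r, hr,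
    fun y => ⟨hU y y.2, rfl⟩⟩⟩

/-- The map on sections over `U` of a morphism `M^~ → N^~`. -/
def sectionMap {M N : GrMod 𝒜} (ε : tilde B M ⟶ tilde B N) (U : Opens (RelSpec 𝒜 B)) :
    ModSec M U →ₗ[RingSec U] ModSec N U :=
  (ε.val.app (op U)).hom

theorem sectionMap_res {M N : GrMod 𝒜} (ε : tilde B M ⟶ tilde B N) {U V : Opens (RelSpec 𝒜 B)}
    (i : V ≤ U) (s : ModSec M U) :
    sectionMap ε V (modRes M i s) = modRes N i (sectionMap ε U s) :=
  PresheafOfModules.naturality_apply ε.val (homOfLE i).op s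

/-- The germ at `P` of the image of the section `m / r` under a morphism `M^~ → N^~`. -/
def germ {M N : GrMod 𝒜} (ε : tilde B M ⟶ tilde B N) (P : RelSpec 𝒜 B) {a : A} {m : M.carrier}
    (hm : m ∈ M.deg a) {r : S} (hr : r ∈ 𝒜 a) (hP : r ∉ P.ideal) : P.Loc N.carrier :=
  (sectionMap ε (RelSpec.basicOpen r) (fracSec hm hr RelSpec.notMem_of_mem_basicOpen)).1 ⟨P, hP⟩

/-! ### Images of homogeneous fractions under a morphism of sheaves -/

section

variable {M N : GrMod 𝒜} (ε : tilde B M ⟶ tilde B N) (P : RelSpec 𝒜 B)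

/-- Morphisms commute with restriction, so the value at `P` depends only on the section near `P`;
there it agrees with a fraction defined on the whole basic open set of its denominator. -/
theorem sectionMap_eq_germ {U : Opens (RelSpec 𝒜 B)} (s : ModSec M U) (hPU : P ∈ U)
    {V : Opens (RelSpec 𝒜 B)} (hPV : P ∈ V) (i : V ≤ U) {a : A} {m : M.carrier}
    (hm : m ∈ M.deg a) {r : S} (hr : r ∈ 𝒜 a) (hP : r ∉ P.ideal)
    (h : ∀ y : V, ∃ hs : r ∉ y.1.ideal, s.1 ⟨y, i y.2⟩ = y.1.frac m hs) :
    (sectionMap ε U s).1 ⟨P, hPU⟩ = germ ε P hm hr hP := by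
  have hV : V ≤ RelSpec.basicOpen r := fun y hy => (h ⟨y, hy⟩).1
  have h1 : modRes M i s = modRes M hV (fracSec hm hr RelSpec.notMem_of_mem_basicOpen) :=
    Subtype.ext <| funext fun y => (h y).2
  have h2 := congrArg (sectionMap ε V) h1
  rw [sectionMap_res, sectionMap_res] at h2
  exact congrFun (congrArg Subtype.val h2) ⟨P, hPV⟩

theorem germ_congr {a a' : A} {m m' : M.carrier} (hm : m ∈ M.deg a) (hm' : m' ∈ M.deg a')
    {r r' : S} (hr : r ∈ 𝒜 a) (hr' : r' ∈ 𝒜 a') (hP : r ∉ P.ideal) (hP' : r' ∉ P.ideal)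
    (h1 : m = m') (h2 : r = r') : germ ε P hm hr hP = germ ε P hm' hr' hP' := by
  subst h1 h2; rfl

theorem germ_add {a : A} {m m' : M.carrier} (hm : m ∈ M.deg a) (hm' : m' ∈ M.deg a)
    {r : S} (hr : r ∈ 𝒜 a) (hP : r ∉ P.ideal) :
    germ ε P (add_mem hm hm') hr hP = germ ε P hm hr hP + germ ε P hm' hr hP := by
  have h : (fracSec (add_mem hm hm') hr RelSpec.notMem_of_mem_basicOpen : ModSec M (RelSpec.basicOpen (B := B) r)) =
      fracSec hm hr RelSpec.notMem_of_mem_basicOpen + fracSec hm' hr RelSpec.notMem_of_mem_basicOpen := by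
    refine Subtype.ext <| funext fun y => RelSpec.smul_left_cancel y.1 y.2 ?_
    have hy : r ∉ y.1.ideal := y.2
    change r • y.1.frac (m + m') hy = r • (y.1.frac m hy + y.1.frac m' hy)
    rw [smul_add, RelSpec.smul_frac, RelSpec.smul_frac, RelSpec.smul_frac, map_add]
  unfold germ
  rw [h, map_add]
  rfl

/-- The section `(c m) / (c' r)` is the degree `0` function `c / c'` times `m / r`. Linearity of `ε`
over the structure sheaf enters here. -/
theorem germ_smul {a e : A} {m : M.carrier} (hm : m ∈ M.deg a) {r : S} (hr : r ∈ 𝒜 a)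
    (hP : r ∉ P.ideal) {c c' : S} (hc : c ∈ 𝒜 e) (hc' : c' ∈ 𝒜 e) (hP' : c' ∉ P.ideal) :
    c' • germ ε P (M.smul_mem hc hm) (SetLike.mul_mem_graded hc' hr) (P.mul_notMem hP' hP) =
      c • germ ε P hm hr hP := by
  have hU : ∀ y ∈ RelSpec.basicOpen (B := B) (𝒜 := 𝒜) (c' * r), r ∉ y.ideal := fun y hy h =>
    hy (y.ideal.mul_mem_left _ h)
  have hU' : ∀ y ∈ RelSpec.basicOpen (B := B) (𝒜 := 𝒜) (c' * r), c' ∉ y.ideal := fun y hy h =>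
    hy (y.ideal.mul_mem_right _ h)
  have h : (fracSec (M.smul_mem hc hm) (SetLike.mul_mem_graded hc' hr) RelSpec.notMem_of_mem_basicOpen :
      ModSec M (RelSpec.basicOpen (B := B) (c' * r))) =
      fracRing hc hc' hU' • fracSec hm hr hU := by
    refine Subtype.ext <| funext fun y => RelSpec.smul_left_cancel y.1 y.2 ?_
    have hy : c' * r ∉ y.1.ideal := y.2
    change (c' * r) • y.1.frac (c • m) hy =
      (c' * r) • ((y.1.frac c (hU' y y.2) : y.1.Loc S) • y.1.frac m (hU y y.2))
    rw [RelSpec.smul_frac, mul_smul, smul_comm c' r, RelSpec.smul_frac_smul, smul_comm r c,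
      RelSpec.smul_frac, map_smul]
  unfold germ
  rw [h, map_smul]
  refine (RelSpec.smul_frac_smul P c hP' _).trans ?_
  rw [show fracSec hm hr hU = modRes M (show RelSpec.basicOpen (c' * r) ≤ RelSpec.basicOpen r from hU)
    (fracSec hm hr RelSpec.notMem_of_mem_basicOpen) from rfl, sectionMap_res]
  rfl

/-- The value of the extended stalk map at `x` has to be `(p / q) ε(q x / p)`, with `p / q` a unit
of the degree of `x`. This identity shows that the value is independent of the unit (take `s = 1`)
and compatible with homogeneous scalars `s`. -/
theorem germ_ratio {a b b' c : A} {x : M.carrier} (hx : x ∈ M.deg a) {s : S} (hs : s ∈ 𝒜 c)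
    {p q p' q' : S} (hq : q ∈ 𝒜 b) (hp : p ∈ 𝒜 (b + a)) (hq' : q' ∈ 𝒜 b')
    (hp' : p' ∈ 𝒜 (b' + (c + a))) (hpP : p ∉ P.ideal) (hqP : q ∉ P.ideal) (hpP' : p' ∉ P.ideal) :
    (q * p') • germ ε P (M.smul_mem hq' (M.smul_mem hs hx)) hp' hpP' =
      (q' * s * p) • germ ε P (M.smul_mem hq hx) hp hpP := by
  have h1 := SetLike.mul_mem_graded (SetLike.mul_mem_graded hq' hs) hp
  have h2 := SetLike.mul_mem_graded hq hp'
  rw [show b + (b' + (c + a)) = b' + c + (b + a) by abel] at h2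
  rw [← germ_smul ε P (M.smul_mem hq hx) hp hpP h1 h2 (P.mul_notMem hqP hpP')]
  congr 1
  -- After expanding `q x / p` by `(q' s p) / (q p')`, the result is also `q' s x / p'` expanded by
  -- `(p q) / (p q)`, and the latter expansion changes nothing.
  have h3 := SetLike.mul_mem_graded hp hq
  have h4 := germ_smul ε P (M.smul_mem hq' (M.smul_mem hs hx)) hp' hpP' h3 h3
    (P.mul_notMem hpP hqP)
  rw [← P.smul_left_cancel (P.mul_notMem hpP hqP) h4]
  refine germ_congr _ _ _ _ _ _ _ _ ?_ ?_
  · simp only [smul_smul]; ring_nf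
  · ring

end

/-! ### Homogeneous units and stalk maps in all degrees -/

variable (𝒜 B) in
/-- At each point, every degree is the degree of a fraction of homogeneous elements that do not
vanish there. -/
class HasHomogeneousUnits : Prop where
  exists_unit : ∀ (P : RelSpec 𝒜 B) (a : A), ∃ (b : A) (p q : S), p ∈ 𝒜 (b + a) ∧ q ∈ 𝒜 b ∧
    p ∉ P.ideal ∧ q ∉ P.ideal

section

variable [HasHomogeneousUnits 𝒜 B] {M N : GrMod 𝒜} (ε : tilde B M ⟶ tilde B N) (P : RelSpec 𝒜 B)

theorem exists_stalkComp (a : A) : ∃ f : M.deg a →+ P.Loc N.carrier,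
    ∀ (x : M.deg a) (b : A) (p q : S) (hp : p ∈ 𝒜 (b + a)) (hq : q ∈ 𝒜 b) (hpP : p ∉ P.ideal),
      q • f x = p • germ ε P (M.smul_mem hq x.2) hp hpP := by
  obtain ⟨b, p, q, hp, hq, hpP, hqP⟩ := HasHomogeneousUnits.exists_unit P a
  refine ⟨AddMonoidHom.mk' (fun x => LocalizedModule.divBy (⟨q, hqP⟩ : P.ideal.primeCompl)
    (p • germ ε P (M.smul_mem hq x.2) hp hpP)) ?_, ?_⟩
  · intro x y
    rw [← map_add, ← smul_add, ← germ_add]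
    congr 2
    exact germ_congr _ _ _ _ _ _ _ _ (smul_add _ _ _) rfl
  · intro x b' p' q' hp' hq' hpP'
    refine P.smul_left_cancel hqP ?_
    have h := LocalizedModule.mul_by_divBy (⟨q, hqP⟩ : P.ideal.primeCompl)
      (p • germ ε P (M.smul_mem hq x.2) hp hpP)
    rw [AddMonoidHom.mk'_apply, smul_comm]
    have h' : q • LocalizedModule.divBy (⟨q, hqP⟩ : P.ideal.primeCompl)
      (p • germ ε P (M.smul_mem hq x.2) hp hpP) = p • germ ε P (M.smul_mem hq x.2) hp hpP := h
    -- Independence of the chosen unit is `germ_ratio` for the scalar `1` of degree `0`.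
    have h0 := hp'
    rw [← zero_add a] at h0
    have h1 := germ_ratio ε P x.2 (SetLike.one_mem_graded 𝒜) hq hp hq' h0 hpP hqP hpP'
    simp only [mul_one] at h1
    refine (congrArg (q' • ·) h').trans ?_
    rw [smul_smul q' p, ← h1, smul_smul q p']
    congr 1
    exact germ_congr _ _ _ _ _ _ _ _ (by rw [one_smul]) rfl

/-- The maps on the single degrees add up to an additive map on the direct sum. Its `S`-linearity
need only be checked on homogeneous scalars and elements, where it is `germ_ratio`. -/
theorem exists_stalkMap : ∃ f : M.carrier →ₗ[S] P.Loc N.carrier,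
    ∀ {a : A} {x : M.carrier} (hx : x ∈ M.deg a) {b : A} {p q : S} (hp : p ∈ 𝒜 (b + a))
      (hq : q ∈ 𝒜 b) (hpP : p ∉ P.ideal),
      q • f x = p • germ ε P (M.smul_mem hq hx) hp hpP := by
  choose E hE using exists_stalkComp ε P
  let := M.isInternal.chooseDecomposition
  let f : M.carrier →+ P.Loc N.carrier :=
    (DirectSum.toAddMonoid E).comp (DirectSum.decomposeAddEquiv M.deg).toAddMonoidHom
  have hf : ∀ {a : A} {x : M.carrier} (hx : x ∈ M.deg a), f x = E a ⟨x, hx⟩ := by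
    intro a x hx
    change DirectSum.toAddMonoid E (DirectSum.decompose M.deg x) = _
    rw [DirectSum.decompose_of_mem M.deg hx]
    exact DirectSum.toAddMonoid_of E a _
  have hf' : ∀ {a : A} {x : M.carrier} (hx : x ∈ M.deg a) {b : A} {p q : S} (hp : p ∈ 𝒜 (b + a))
      (hq : q ∈ 𝒜 b) (hpP : p ∉ P.ideal),
      q • f x = p • germ ε P (M.smul_mem hq hx) hp hpP := by
    intro a x hx b p q hp hq hpP
    rw [hf hx]
    exact hE a ⟨x, hx⟩ b p q hp hq hpP
  have hs : ∀ {c a : A} {s : S} {x : M.carrier}, s ∈ 𝒜 c → x ∈ M.deg a → f (s • x) = s • f x := by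
    intro c a s x hs hx
    obtain ⟨b, p, q, hp, hq, hpP, hqP⟩ := HasHomogeneousUnits.exists_unit P a
    obtain ⟨b', p', q', hp', hq', hpP', hqP'⟩ := HasHomogeneousUnits.exists_unit P (c + a)
    refine P.smul_left_cancel (P.mul_notMem hqP hqP') ?_
    rw [mul_smul, hf' (M.smul_mem hs hx) hp' hq' hpP', smul_smul,
      germ_ratio ε P hx hs hq hp hq' hp' hpP hqP hpP', mul_smul, ← hf' hx hp hq hpP, smul_smul,
      smul_smul]
    ring_nf
  refine ⟨{ f with map_smul' := ?_ }, hf'⟩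
  intro r m
  change f (r • m) = r • f m
  obtain ⟨s, h⟩ := GrMod.exists_sum_decompose (𝒜 := 𝒜) r
  obtain ⟨t, h'⟩ := M.exists_sum_proj m
  rw [← h s subset_rfl, ← h' t subset_rfl, map_sum]
  simp only [Finset.sum_smul, Finset.smul_sum, map_sum]
  exact Finset.sum_congr rfl fun a _ => Finset.sum_congr rfl fun c _ =>
    hs (SetLike.coe_mem _) (M.proj_mem a m)

/-- The stalk at `P` of a morphism `M^~ → N^~`, extended to elements of all degrees. -/
def stalkMap : M.carrier →ₗ[S] P.Loc N.carrier := (exists_stalkMap ε P).choose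

theorem smul_stalkMap {a : A} {x : M.carrier} (hx : x ∈ M.deg a) {b : A} {p q : S}
    (hp : p ∈ 𝒜 (b + a)) (hq : q ∈ 𝒜 b) (hpP : p ∉ P.ideal) :
    q • stalkMap ε P x = p • germ ε P (M.smul_mem hq hx) hp hpP :=
  (exists_stalkMap ε P).choose_spec hx hp hq hpP

theorem stalkMap_eq {a : A} {x : M.carrier} (hx : x ∈ M.deg a) {r : S} (hr : r ∈ 𝒜 a)
    (hP : r ∉ P.ideal) : stalkMap ε P x = r • germ ε P hx hr hP := by
  have hr' := hr
  rw [← zero_add a] at hr'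
  have := smul_stalkMap ε P hx hr' (SetLike.one_mem_graded 𝒜) hP
  rw [one_smul] at this
  rw [this]
  congr 1
  exact germ_congr _ _ _ _ _ _ _ _ (one_smul _ _) rfl

theorem stalkMap_tildeMap {M N L : GrMod 𝒜} (f : M.Hom N) (ε : tilde B N ⟶ tilde B L)
    (x : M.carrier) : stalkMap (tildeMap B f ≫ ε) P x = stalkMap ε P (f.toLin x) := by
  -- By additivity `x` may be taken homogeneous; both sides are then compared after multiplication
  -- by `q`, which turns them into germs of sections of degree `0`.
  obtain ⟨t, h⟩ := M.exists_sum_proj x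
  rw [← h t subset_rfl, map_sum, map_sum, map_sum]
  refine Finset.sum_congr rfl fun a _ => ?_
  have hx := M.proj_mem a x
  generalize M.proj a x = x at hx
  obtain ⟨b, p, q, hp, hq, hpP, hqP⟩ := HasHomogeneousUnits.exists_unit P a
  refine P.smul_left_cancel hqP ?_
  rw [smul_stalkMap _ P hx hp hq hpP, smul_stalkMap _ P (f.map_deg hx) hp hq hpP]
  congr 1
  unfold germ
  have : (fracSec (N.smul_mem hq (f.map_deg hx)) hp RelSpec.notMem_of_mem_basicOpen :
      ModSec N (RelSpec.basicOpen (B := B) p)) =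
      tildeMapSections f _ (fracSec (M.smul_mem hq hx) hp RelSpec.notMem_of_mem_basicOpen) :=
    Subtype.ext <| funext fun y => (congrArg (LocalizedModule.mk · _)
      (map_smul f.toLin q x).symm).trans (LocalizedModule.map_mk _ f.toLin _ _).symm
  rw [this]
  rfl

theorem stalkMap_id (x : M.carrier) : stalkMap (𝟙 (tilde B M)) P x = P.toLoc _ x := by
  obtain ⟨t, h⟩ := M.exists_sum_proj x
  rw [← h t subset_rfl, map_sum, map_sum]
  refine Finset.sum_congr rfl fun a _ => ?_
  have hx := M.proj_mem a x
  generalize M.proj a x = x at hx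
  obtain ⟨b, p, q, hp, hq, hpP, hqP⟩ := HasHomogeneousUnits.exists_unit P a
  refine P.smul_left_cancel hqP ?_
  rw [smul_stalkMap _ P hx hp hq hpP, ← map_smul]
  exact P.smul_frac _ _

theorem stalkMap_tildeMap' (f : M.Hom N) (x : M.carrier) :
    stalkMap (tildeMap B f) P x = P.toLoc _ (f.toLin x) := by
  rw [← stalkMap_id, ← stalkMap_tildeMap, Category.comp_id]

theorem stalkMap_zero (x : M.carrier) : stalkMap (0 : tilde B M ⟶ tilde B N) P x = 0 := by
  obtain ⟨t, h⟩ := M.exists_sum_proj x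
  rw [← h t subset_rfl, map_sum]
  refine Finset.sum_eq_zero fun a _ => ?_
  have hx := M.proj_mem a x
  generalize M.proj a x = x at hx
  obtain ⟨b, p, q, hp, hq, hpP, hqP⟩ := HasHomogeneousUnits.exists_unit P a
  refine P.smul_left_cancel hqP ?_
  rw [smul_stalkMap _ P hx hp hq hpP, smul_zero]
  exact (congrArg (p • ·) rfl).trans (smul_zero p)

end
/-! ### Exactness of sequences of sheaves in terms of elements -/

theorem exists_decompose_notMem (P : RelSpec 𝒜 B) {t : S} (ht : t ∉ P.ideal) :
    ∃ c, (DirectSum.decompose 𝒜 t c : S) ∉ P.ideal := by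
  by_contra! h
  obtain ⟨s, hs⟩ := GrMod.exists_sum_decompose (𝒜 := 𝒜) t
  exact ht (hs s subset_rfl ▸ sum_mem fun c _ => h c)

/-- Any `t ∉ P` with `t x = t y` has a homogeneous component outside `P`; projecting the equation to
the matching degree replaces `t` by that component. -/
theorem exists_homogeneous_smul_eq (P : RelSpec 𝒜 B) (M : GrMod 𝒜) {a : A} {x y : M.carrier}
    (hx : x ∈ M.deg a) (hy : y ∈ M.deg a) (h : P.toLoc _ x = P.toLoc _ y) :
    ∃ (c : A) (t : S), t ∈ 𝒜 c ∧ t ∉ P.ideal ∧ t • x = t • y := by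
  obtain ⟨t, ht, h⟩ := P.toLoc_eq_iff.1 h
  obtain ⟨c, hc⟩ := exists_decompose_notMem P ht
  refine ⟨c, _, SetLike.coe_mem _, hc, ?_⟩
  have := congrArg (M.proj (c + a)) h
  rwa [M.proj_smul t hx, M.proj_smul t hy, add_sub_cancel_right] at this

theorem RelSpec.frac_eq_frac_iff (P : RelSpec 𝒜 B) {M : Type u} [AddCommGroup M] [Module S M]
    {m m' : M} {r r' : S} (hr : r ∉ P.ideal) (hr' : r' ∉ P.ideal) :
    P.frac m hr = P.frac m' hr' ↔ P.toLoc M (r' • m) = P.toLoc M (r • m') := by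
  rw [map_smul, map_smul, ← P.smul_frac m hr, ← P.smul_frac m' hr', smul_comm]
  exact ⟨fun h => by rw [h], fun h => P.smul_left_cancel hr (P.smul_left_cancel hr' (by
    rw [smul_comm, h, smul_comm]))⟩

theorem ModSec.exists_frac {M : GrMod 𝒜} {U : Opens (RelSpec 𝒜 B)} (s : ModSec M U)
    {P : RelSpec 𝒜 B} (hP : P ∈ U) :
    ∃ (V : Opens (RelSpec 𝒜 B)) (_ : P ∈ V) (i : V ≤ U) (a : A) (m : M.carrier) (_ : m ∈ M.deg a)
      (r : S) (_ : r ∈ 𝒜 a) (hr : ∀ y ∈ V, r ∉ y.ideal),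
      ∀ y : V, s.1 ⟨y, i y.2⟩ = y.1.frac m (hr y y.2) := by
  obtain ⟨V, hV, i, a, m, hm, r, hr, h⟩ := s.2 ⟨P, hP⟩
  exact ⟨V, hV, i, a, m, hm, r, hr, fun y hy => (h ⟨y, hy⟩).1, fun y => (h y).2⟩

/-- Near `P` both sections are fractions, and their equality at `P` is witnessed by one `t ∉ P`,
which is still a witness wherever `t` does not vanish. -/
theorem ModSec.exists_eq_of_eq {M : GrMod 𝒜} {U : Opens (RelSpec 𝒜 B)} (s s' : ModSec M U)
    {P : RelSpec 𝒜 B} (hP : P ∈ U) (h : s.1 ⟨P, hP⟩ = s'.1 ⟨P, hP⟩) :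
    ∃ (V : Opens (RelSpec 𝒜 B)) (_ : P ∈ V) (i : V ≤ U), ∀ y : V,
      s.1 ⟨y, i y.2⟩ = s'.1 ⟨y, i y.2⟩ := by
  obtain ⟨V, hV, i, a, m, hm, r, hr, hrV, hs⟩ := s.exists_frac hP
  obtain ⟨V', hV', i', a', m', hm', r', hr', hrV', hs'⟩ := s'.exists_frac hP
  rw [hs ⟨P, hV⟩, hs' ⟨P, hV'⟩, RelSpec.frac_eq_frac_iff, RelSpec.toLoc_eq_iff] at h
  obtain ⟨t, ht, h⟩ := h
  refine ⟨V ⊓ V' ⊓ RelSpec.basicOpen t, ⟨⟨hV, hV'⟩, ht⟩,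
    (inf_le_left.trans inf_le_left).trans i, fun y => ?_⟩
  rw [hs ⟨y, y.2.1.1⟩, hs' ⟨y, y.2.1.2⟩, RelSpec.frac_eq_frac_iff, RelSpec.toLoc_eq_iff]
  exact ⟨t, y.2.2, h⟩

theorem tilde_hom_ext {M N : GrMod 𝒜} {φ ψ : tilde B M ⟶ tilde B N}
    (h : ∀ U s, sectionMap φ U s = sectionMap ψ U s) : φ = ψ := by
  refine SheafOfModules.Hom.ext (PresheafOfModules.Hom.ext ?_)
  funext U
  exact ModuleCat.hom_ext (LinearMap.ext fun s => h U.unop s)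

theorem tildeMap_surjective {M N : GrMod 𝒜} (f : M.Hom N) (hf : Function.Surjective f.toLin) :
    SheafSurjective (tildeMap B f) := by
  intro U s P hP
  obtain ⟨V, hV, i, a, m, hm, r, hr, hrV, hs⟩ := ModSec.exists_frac (show ModSec N U from s) hP
  obtain ⟨x, rfl⟩ := hf m
  refine ⟨V, hV, homOfLE i, fracSec (M.proj_mem a x) hr hrV, Subtype.ext <| funext fun y => ?_⟩
  refine ((LocalizedModule.map_mk _ f.toLin _ _).trans ?_).trans (hs y).symm
  rw [← f.proj_comm, N.proj_same hm]
  rfl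

theorem tildeMap_exact {M N L : GrMod 𝒜} (f : M.Hom N) (g : N.Hom L)
    (h : Function.Exact f.toLin g.toLin) : SheafExact (tildeMap B f) (tildeMap B g) := by
  constructor
  · refine tilde_hom_ext fun U s => Subtype.ext <| funext fun y => ?_
    change LocalizedModule.map _ g.toLin (LocalizedModule.map _ f.toLin (s.1 y)) = 0
    induction s.1 y using LocalizedModule.induction_on with
    | h m t =>
      rw [LocalizedModule.map_mk, LocalizedModule.map_mk, h.apply_apply_eq_zero,
        LocalizedModule.zero_mk]
  · intro U s hs0 P hP
    obtain ⟨V, hV, i, a, m, hm, r, hr, hrV, hs⟩ := ModSec.exists_frac (show ModSec N U from s) hP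
    have h0 : P.frac (g.toLin m) (hrV P hV) = 0 := by
      have h1 : LocalizedModule.map P.ideal.primeCompl g.toLin
          ((show ModSec N U from s).1 ⟨P, hP⟩) = 0 :=
        congrFun (congrArg Subtype.val hs0) ⟨P, hP⟩
      rw [hs ⟨P, hV⟩] at h1
      exact (LocalizedModule.map_mk _ g.toLin _ _).symm.trans h1
    have h1 : P.toLoc _ (g.toLin m) = P.toLoc _ 0 := by
      rw [← P.smul_frac _ (hrV P hV), h0, smul_zero, map_zero]
    -- The numerator `m` lies in the kernel of `g` only after multiplication by `t`, so the local
    -- lift of `m / r` has a preimage of `t m` as numerator and `t r` as denominator.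
    obtain ⟨c, t, ht, htP, h2⟩ := exists_homogeneous_smul_eq P L (g.map_deg hm) (zero_mem _) h1
    rw [smul_zero, ← map_smul] at h2
    obtain ⟨z, hz⟩ := (h _).1 h2
    have hW : ∀ y ∈ V ⊓ RelSpec.basicOpen t, t * r ∉ y.ideal := fun y hy =>
      y.mul_notMem hy.2 (hrV y hy.1)
    refine ⟨V ⊓ RelSpec.basicOpen t, ⟨hV, htP⟩, homOfLE (inf_le_left.trans i),
      fracSec (M.proj_mem (c + a) z) (SetLike.mul_mem_graded ht hr) hW,
      Subtype.ext <| funext fun y => ?_⟩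
    refine ((LocalizedModule.map_mk _ f.toLin _ _).trans ?_).trans (hs ⟨y, y.2.1⟩).symm
    rw [← f.proj_comm, hz, N.proj_same (N.smul_mem ht hm)]
    refine (y.1.frac_eq_frac_iff (hW y y.2) (hrV y y.2.1)).2 ?_
    rw [smul_smul, mul_comm]

theorem GrMod.freeResolution_isVirtualResolution [IsNoetherianRing S] (M : GrMod 𝒜)
    (hM : Module.Finite S M.carrier) : IsVirtualResolution B (M.freeResolution hM) M :=
  ⟨tildeMap B (M.freeResolutionAug hM),
    tildeMap_surjective _ (M.freeResolutionAug_surjective hM),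
    tildeMap_exact _ _ (M.freeResolutionAug_exact hM),
    fun i => tildeMap_exact _ _ (M.freeResolution_exact hM i)⟩

/-! ### Sheaf exactness as exactness up to homogeneous denominators -/

section

variable [HasHomogeneousUnits 𝒜 B]

/-- Multiplied by suitable units, the two values become germs of sections of the same sheaf, and
sections that agree at a point agree near it. -/
theorem stalkMap_eq_near {M M' N : GrMod 𝒜} (ε : tilde B M ⟶ tilde B N)
    (ε' : tilde B M' ⟶ tilde B N) (P : RelSpec 𝒜 B) {a : A} {x : M.carrier} (hx : x ∈ M.deg a)
    {y : M'.carrier} (hy : y ∈ M'.deg a) (h : stalkMap ε P x = stalkMap ε' P y) :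
    ∃ V : Opens (RelSpec 𝒜 B), P ∈ V ∧ ∀ Q ∈ V, stalkMap ε Q x = stalkMap ε' Q y := by
  obtain ⟨b, p, q, hp, hq, hpP, hqP⟩ := HasHomogeneousUnits.exists_unit P a
  have h1 := congrArg (q • ·) h
  simp only [smul_stalkMap _ P hx hp hq hpP, smul_stalkMap _ P hy hp hq hpP] at h1
  obtain ⟨V, hV, i, hV'⟩ := ModSec.exists_eq_of_eq
    (sectionMap ε _ (fracSec (M.smul_mem hq hx) hp RelSpec.notMem_of_mem_basicOpen))
    (sectionMap ε' _ (fracSec (M'.smul_mem hq hy) hp RelSpec.notMem_of_mem_basicOpen)) hpP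
    (P.smul_left_cancel hpP h1)
  refine ⟨V ⊓ RelSpec.basicOpen q, ⟨hV, hqP⟩, fun Q hQ => Q.smul_left_cancel hQ.2 ?_⟩
  rw [smul_stalkMap _ Q hx hp hq (i hQ.1), smul_stalkMap _ Q hy hp hq (i hQ.1)]
  exact congrArg (p • ·) (hV' ⟨Q, hQ.1⟩)

theorem SheafSurjective.exists_stalkMap_eq {M M' N : GrMod 𝒜} {ε : tilde B M ⟶ tilde B N}
    (hε : SheafSurjective ε) (ε' : tilde B M' ⟶ tilde B N) (P : RelSpec 𝒜 B) {a : A}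
    {y : M'.carrier} (hy : y ∈ M'.deg a) :
    ∃ (c : A) (t : S) (x : M.carrier), t ∈ 𝒜 c ∧ t ∉ P.ideal ∧ x ∈ M.deg (c + a) ∧
      stalkMap ε P x = t • stalkMap ε' P y := by
  obtain ⟨b, p, q, hp, hq, hpP, hqP⟩ := HasHomogeneousUnits.exists_unit P a
  obtain ⟨V, hV, i, s, hs⟩ := hε _
    (sectionMap ε' _ (fracSec (M'.smul_mem hq hy) hp RelSpec.notMem_of_mem_basicOpen)) P hpP
  obtain ⟨W, hW, j, c, n, hn, r, hr, hrW, hsn⟩ := ModSec.exists_frac (show ModSec M V from s) hV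
  have h1 : (sectionMap ε V (show ModSec M V from s)).1 ⟨P, hV⟩ =
      germ ε' P (M'.smul_mem hq hy) hp hpP := congrFun (congrArg Subtype.val hs) ⟨P, hV⟩
  rw [sectionMap_eq_germ ε P _ hV hW j hn hr (hrW P hW)
    fun y => ⟨hrW y y.2, hsn y⟩] at h1
  -- The degree `0` section `ε'(q y / p)` lifts near `P` to `n / r`; clearing denominators makes `p
  -- n` a lift of `r q y`.
  refine ⟨c + b, r * q, p • n, SetLike.mul_mem_graded hr hq, P.mul_notMem (hrW P hW) hqP, ?_, ?_⟩
  · have := M.smul_mem hp hn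
    rwa [show b + a + c = c + b + a by abel] at this
  · rw [map_smul, stalkMap_eq ε P hn hr (hrW P hW), h1, mul_smul, smul_stalkMap ε' P hy hp hq hpP,
      smul_comm]

theorem SheafExact.stalkMap_apply {M N L : GrMod 𝒜} {f : M.Hom N} {ψ : tilde B N ⟶ tilde B L}
    (h : SheafExact (tildeMap B f) ψ) (P : RelSpec 𝒜 B) (y : M.carrier) :
    stalkMap ψ P (f.toLin y) = 0 := by
  rw [← stalkMap_tildeMap, h.1, stalkMap_zero]

/-- The section `q x / p` is killed by `ψ` near `P`, hence is locally the image of some `n / r`.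
Equality of `f(n) / r` and `q x / p` at `P` gives `t p f(n) = t r q x` with `t ∉ P` homogeneous. -/
theorem SheafExact.exists_of_stalkMap_eq_zero {M N L : GrMod 𝒜} {f : M.Hom N}
    {ψ : tilde B N ⟶ tilde B L} (h : SheafExact (tildeMap B f) ψ) (P : RelSpec 𝒜 B) {a : A}
    {x : N.carrier} (hx : x ∈ N.deg a) (h0 : stalkMap ψ P x = 0) :
    ∃ (c : A) (t : S) (y : M.carrier), t ∈ 𝒜 c ∧ t ∉ P.ideal ∧ y ∈ M.deg (c + a) ∧
      f.toLin y = t • x := by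
  obtain ⟨b, p, q, hp, hq, hpP, hqP⟩ := HasHomogeneousUnits.exists_unit P a
  have h1 := smul_stalkMap ψ P hx hp hq hpP
  rw [h0, smul_zero, ← smul_zero p] at h1
  obtain ⟨V, hV, i, hV'⟩ := ModSec.exists_eq_of_eq
    (sectionMap ψ _ (fracSec (N.smul_mem hq hx) hp RelSpec.notMem_of_mem_basicOpen)) 0 hpP
    (P.smul_left_cancel hpP h1).symm
  have h2 : sectionMap ψ V (fracSec (N.smul_mem hq hx) hp i) = 0 := by
    rw [show fracSec (N.smul_mem hq hx) hp i = modRes N i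
      (fracSec (N.smul_mem hq hx) hp RelSpec.notMem_of_mem_basicOpen) from rfl, sectionMap_res]
    exact Subtype.ext <| funext hV'
  obtain ⟨W, hW, j, s, hs⟩ := h.2 V (fracSec (N.smul_mem hq hx) hp i) h2 P hV
  obtain ⟨W', hW', j', c, n, hn, r, hr, hrW, hsn⟩ := ModSec.exists_frac (show ModSec M W from s) hW
  have h3 : LocalizedModule.map P.ideal.primeCompl f.toLin ((show ModSec M W from s).1 ⟨P, hW⟩) =
    P.frac (q • x) hpP := congrFun (congrArg Subtype.val hs) ⟨P, hW⟩
  rw [hsn ⟨P, hW'⟩] at h3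
  have h4 := (P.frac_eq_frac_iff (hrW P hW') hpP).1 ((LocalizedModule.map_mk _ f.toLin _ _).symm.trans h3)
  have hpn := N.smul_mem hp (f.map_deg hn)
  have hrx := N.smul_mem hr (N.smul_mem hq hx)
  rw [show c + (b + a) = b + a + c by abel] at hrx
  obtain ⟨e, t, ht, htP, h5⟩ := exists_homogeneous_smul_eq P N hpn hrx h4
  refine ⟨e + c + b, t * r * q, t • p • n,
    SetLike.mul_mem_graded (SetLike.mul_mem_graded ht hr) hq,
    P.mul_notMem (P.mul_notMem htP (hrW P hW')) hqP, ?_, ?_⟩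
  · have := M.smul_mem ht (M.smul_mem hp hn)
    rwa [show e + (b + a + c) = e + c + b + a by abel] at this
  · rw [map_smul, map_smul, h5, smul_smul, smul_smul]

theorem SheafExact.exists_of_apply_eq_zero {M N L : GrMod 𝒜} {f : M.Hom N} {g : N.Hom L}
    (h : SheafExact (tildeMap B f) (tildeMap B g)) (P : RelSpec 𝒜 B) {a : A}
    {x : N.carrier} (hx : x ∈ N.deg a) (h0 : g.toLin x = 0) :
    ∃ (c : A) (t : S) (y : M.carrier), t ∈ 𝒜 c ∧ t ∉ P.ideal ∧ y ∈ M.deg (c + a) ∧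
      f.toLin y = t • x :=
  h.exists_of_stalkMap_eq_zero P hx (by rw [stalkMap_tildeMap', h0, map_zero])

end
/-! ### Chain maps up to denominators -/

/-- The linear map `φ` is homogeneous of degree `c`. -/
def HasDegree {M N : GrMod 𝒜} (c : A) (φ : M.carrier →ₗ[S] N.carrier) : Prop :=
  ∀ (a : A) (x : M.carrier), x ∈ M.deg a → φ x ∈ N.deg (c + a)

namespace HasDegree

variable {M N L : GrMod 𝒜} {c c' : A}

theorem zero : HasDegree c (0 : M.carrier →ₗ[S] N.carrier) := fun _ _ _ => zero_mem _

theorem sub {φ ψ : M.carrier →ₗ[S] N.carrier} (hφ : HasDegree c φ) (hψ : HasDegree c ψ) :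
    HasDegree c (φ - ψ) := fun a x hx => sub_mem (hφ a x hx) (hψ a x hx)

theorem smul {φ : M.carrier →ₗ[S] N.carrier} (hφ : HasDegree c φ) {s : S} (hs : s ∈ 𝒜 c') :
    HasDegree (c' + c) (s • φ) := fun a x hx => by
  rw [add_assoc]
  exact N.smul_mem hs (hφ a x hx)

theorem comp {φ : M.carrier →ₗ[S] N.carrier} {ψ : N.carrier →ₗ[S] L.carrier}
    (hψ : HasDegree c' ψ) (hφ : HasDegree c φ) : HasDegree (c' + c) (ψ ∘ₗ φ) := fun a x hx => by
  rw [add_assoc]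
  exact hψ _ _ (hφ a x hx)

theorem comp_hom {ψ : N.carrier →ₗ[S] L.carrier} (hψ : HasDegree c ψ) (f : M.Hom N) :
    HasDegree c (ψ ∘ₗ f.toLin) := fun a _ hx => hψ a _ (f.map_deg hx)

theorem of_basis {n : ℕ} (b : Module.Basis (Fin n) S M.carrier) {d : Fin n → A}
    (hb : ∀ j, b j ∈ M.deg (d j)) {φ : M.carrier →ₗ[S] N.carrier}
    (h : ∀ j, φ (b j) ∈ N.deg (c + d j)) : HasDegree c φ := by
  intro a x hx
  have hx' : x = ∑ j, (DirectSum.decompose 𝒜 (b.repr x j) (a - d j) : S) • b j := by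
    conv_lhs => rw [← M.proj_same hx, ← b.sum_repr x, map_sum]
    exact Finset.sum_congr rfl fun j _ => M.proj_smul _ (hb j) a
  rw [hx', map_sum]
  refine sum_mem fun j _ => ?_
  rw [map_smul]
  have := N.smul_mem (SetLike.coe_mem (DirectSum.decompose 𝒜 (b.repr x j) (a - d j))) (h j)
  rwa [show a - d j + (c + d j) = c + a by abel] at this

end HasDegree

/-- Lifting a homogeneous map from a graded free module, up to a denominator, along a map that is
surjective up to denominators. -/
theorem exists_lift_of_isGrFree (P : RelSpec 𝒜 B) {G E : GrMod 𝒜} (hG : G.IsGrFree) {L : Type u}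
    [AddCommGroup L] [Module S L] (f : E.carrier →ₗ[S] L) (θ : G.carrier →ₗ[S] L) (c : A)
    (h : ∀ (a : A) (x : G.carrier), x ∈ G.deg a → ∃ (c' : A) (t : S) (y : E.carrier),
      t ∈ 𝒜 c' ∧ t ∉ P.ideal ∧ y ∈ E.deg (c' + (c + a)) ∧ f y = t • θ x) :
    ∃ (C : A) (T : S) (ψ : G.carrier →ₗ[S] E.carrier), T ∈ 𝒜 C ∧ T ∉ P.ideal ∧
      HasDegree (C + c) ψ ∧ f ∘ₗ ψ = T • θ := by
  classical
  obtain ⟨n, b, d, hb⟩ := hG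
  choose c' t y ht htP hy hf using fun j => h (d j) (b j) (hb j)
  -- The common denominator is the product over the basis; the lift of the `j`-th basis vector is
  -- scaled by the denominators of all the others.
  refine ⟨∑ j, c' j, ∏ j, t j, b.constr S fun j => (∏ i ∈ Finset.univ.erase j, t i) • y j,
    SetLike.prod_mem_graded _ _ _ fun j _ => ht j, ?_, ?_, ?_⟩
  · exact P.ideal.primeCompl.prod_mem fun j _ => htP j
  · refine HasDegree.of_basis b hb fun j => ?_
    rw [Module.Basis.constr_basis]
    have := E.smul_mem (SetLike.prod_mem_graded 𝒜 c' t (F := Finset.univ.erase j)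
      fun i _ => ht i) (hy j)
    rwa [← add_assoc, Finset.sum_erase_add _ _ (Finset.mem_univ j), ← add_assoc] at this
  · refine b.ext fun j => ?_
    rw [LinearMap.comp_apply, Module.Basis.constr_basis, map_smul, hf, smul_smul,
      Finset.prod_erase_mul _ _ (Finset.mem_univ j)]
    rfl

/-! ### Fractional chain maps and their existence at a point -/

/-- The morphism `ε` makes `0 ← M^~ ← F_0^~ ← F_1^~ ← ⋯` exact. -/
structure FreeComplex.IsAugmentation (F : FreeComplex 𝒜) {M : GrMod 𝒜}
    (ε : tilde B (F.X 0) ⟶ tilde B M) : Prop where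
  surjective : SheafSurjective ε
  exact_zero : SheafExact (tildeMap B (F.d 0)) ε
  exact_succ : ∀ i, SheafExact (tildeMap B (F.d (i + 1))) (tildeMap B (F.d i))

/-- A homogeneous map `G → F` that commutes with the differentials in degrees `≤ n`, together with
a denominator of the same degree. -/
structure FractionalChainMap (n : ℕ) (G F : FreeComplex 𝒜) where
  shift : A
  denom : S
  denom_mem : denom ∈ 𝒜 shift
  map : ∀ j, (G.X j).carrier →ₗ[S] (F.X j).carrier
  hasDegree : ∀ j, HasDegree shift (map j)
  comm : ∀ j < n, (F.d j).toLin ∘ₗ map (j + 1) = map j ∘ₗ (G.d j).toLin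

namespace FractionalChainMap

variable {n : ℕ} {F G H : FreeComplex 𝒜}

/-- The identity. -/
def id (n : ℕ) (F : FreeComplex 𝒜) : FractionalChainMap n F F where
  shift := 0
  denom := 1
  denom_mem := SetLike.one_mem_graded 𝒜
  map _ := LinearMap.id
  hasDegree _ a x hx := by rwa [zero_add]
  comm _ _ := rfl

/-- Composition. -/
def comp (K : FractionalChainMap n G F) (L : FractionalChainMap n H G) :
    FractionalChainMap n H F where
  shift := K.shift + L.shift
  denom := K.denom * L.denom
  denom_mem := SetLike.mul_mem_graded K.denom_mem L.denom_mem
  map j := K.map j ∘ₗ L.map j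
  hasDegree j := (K.hasDegree j).comp (L.hasDegree j)
  comm j hj := by
    rw [← LinearMap.comp_assoc, K.comm j hj, LinearMap.comp_assoc, L.comm j hj,
      LinearMap.comp_assoc]

variable [HasHomogeneousUnits 𝒜 B] {M : GrMod 𝒜}

/-- At `P`, the fractional chain map is compatible with the augmentations. -/
def IsLift (L : FractionalChainMap n G F) (ε' : tilde B (G.X 0) ⟶ tilde B M)
    (ε : tilde B (F.X 0) ⟶ tilde B M) (P : RelSpec 𝒜 B) : Prop :=
  L.denom ∉ P.ideal ∧ ∀ x, stalkMap ε P (L.map 0 x) = L.denom • stalkMap ε' P x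

theorem isLift_id (ε : tilde B (F.X 0) ⟶ tilde B M) (P : RelSpec 𝒜 B) :
    (id n F).IsLift ε ε P :=
  ⟨P.one_notMem, fun _ => (one_smul _ _).symm⟩

variable {ε : tilde B (F.X 0) ⟶ tilde B M} {ε' : tilde B (G.X 0) ⟶ tilde B M}
  {ε'' : tilde B (H.X 0) ⟶ tilde B M} {P : RelSpec 𝒜 B}

theorem IsLift.comp {K : FractionalChainMap n G F} {L : FractionalChainMap n H G}
    (hK : K.IsLift ε' ε P) (hL : L.IsLift ε'' ε' P) : (K.comp L).IsLift ε'' ε P :=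
  ⟨P.mul_notMem hK.1 hL.1, fun x => by
    change stalkMap ε P (K.map 0 (L.map 0 x)) = (K.denom * L.denom) • _
    rw [hK.2, hL.2, smul_smul]⟩

/-- Compatibility with the augmentations can be tested on the finite basis of `G_0`, where it is
finitely many equalities that persist near `P`. -/
theorem IsLift.eventually {L : FractionalChainMap n G F} (hL : L.IsLift ε' ε P) :
    ∀ᶠ Q in nhds P, L.IsLift ε' ε Q := by
  obtain ⟨m, b, d, hb⟩ := G.free 0
  have h1 : ∀ j, ∀ᶠ Q in nhds P, stalkMap ε Q (L.map 0 (b j)) = stalkMap ε' Q (L.denom • b j) := by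
    intro j
    obtain ⟨V, hV, h⟩ := stalkMap_eq_near ε ε' P (L.hasDegree 0 _ _ (hb j))
      ((G.X 0).smul_mem L.denom_mem (hb j)) ((hL.2 _).trans (map_smul _ _ _).symm)
    exact Filter.eventually_of_mem (V.2.mem_nhds hV) h
  filter_upwards [Filter.eventually_all.2 h1,
    (RelSpec.basicOpen (𝒜 := 𝒜) (B := B) L.denom).2.mem_nhds hL.1] with Q h2 h3
  refine ⟨h3, fun x => ?_⟩
  have : stalkMap ε Q ∘ₗ L.map 0 = L.denom • stalkMap ε' Q :=
    b.ext fun j => (h2 j).trans (map_smul _ _ _)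
  exact LinearMap.congr_fun this x

/-- The comparison theorem for resolutions, up to denominators. Each further degree may cost a new
denominator, by which all earlier maps must be multiplied; this is why only a finite range of
degrees is required to commute. -/
theorem exists_isLift (hε : F.IsAugmentation ε) (hε' : G.IsAugmentation ε') (P : RelSpec 𝒜 B) :
    ∀ n, ∃ L : FractionalChainMap n G F, L.IsLift ε' ε P
  | 0 => by
    obtain ⟨C, T, ψ, hT, hTP, hψ, h⟩ := exists_lift_of_isGrFree P (G.free 0) (stalkMap ε P)
      (stalkMap ε' P) 0 (fun a x hx => by
        rw [zero_add]
        exact hε.surjective.exists_stalkMap_eq ε' P hx)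
    rw [add_zero] at hψ
    -- The zero maps above degree `0` are fillers: for `n = 0` no square has to commute.
    refine ⟨⟨C, T, hT, Function.update (fun _ => 0) 0 ψ, fun j => ?_, fun j hj => by omega⟩,
      hTP, fun x => LinearMap.congr_fun h x⟩
    rcases eq_or_ne j 0 with rfl | hj
    · rwa [Function.update_self]
    · rw [Function.update_of_ne hj]
      exact HasDegree.zero
  | n + 1 => by
    obtain ⟨L, hLP, hL⟩ := exists_isLift hε hε' P n
    obtain ⟨C, T, ψ, hT, hTP, hψ, h⟩ := exists_lift_of_isGrFree P (G.free (n + 1)) (F.d n).toLin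
      (L.map n ∘ₗ (G.d n).toLin) L.shift (fun a x hx => by
        have hx' := (L.hasDegree n).comp_hom (G.d n) a x hx
        -- The map `L_n d` lands in the cycles of `F`: at `F_0` a cycle is an element killed by the
        -- stalk of `ε`, in higher degrees one killed by the differential.
        cases n with
        | zero =>
          refine hε.exact_zero.exists_of_stalkMap_eq_zero P hx' ?_
          rw [LinearMap.comp_apply, hL, hε'.exact_zero.stalkMap_apply, smul_zero]
        | succ m =>
          refine (hε.exact_succ m).exists_of_apply_eq_zero P hx' ?_
          rw [← LinearMap.comp_apply, ← LinearMap.comp_assoc, L.comm m m.lt_succ_self,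
            LinearMap.comp_assoc, G.d_comp_d, LinearMap.comp_zero, LinearMap.zero_apply])
    -- Since `d ψ = T L_n d`, the new square commutes once the earlier maps and the denominator are
    -- multiplied by `T`.
    refine ⟨⟨C + L.shift, T * L.denom, SetLike.mul_mem_graded hT L.denom_mem,
      Function.update (fun j => T • L.map j) (n + 1) ψ, fun j => ?_, fun j hj => ?_⟩,
      P.mul_notMem hTP hLP, fun x => ?_⟩
    · rcases eq_or_ne j (n + 1) with rfl | hj
      · rwa [Function.update_self]
      · rw [Function.update_of_ne hj]
        exact (L.hasDegree j).smul hT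
    · rw [Function.update_of_ne (by omega : j ≠ n + 1)]
      rcases eq_or_ne j n with rfl | hj'
      · rw [Function.update_self, h, LinearMap.smul_comp]
      · rw [Function.update_of_ne (by omega : j + 1 ≠ n + 1), LinearMap.comp_smul,
          L.comm j (by omega), LinearMap.smul_comp]
    · change stalkMap ε P (Function.update (fun j => T • L.map j) (n + 1) ψ 0 x) = _
      rw [Function.update_of_ne (by omega : 0 ≠ n + 1), LinearMap.smul_apply, map_smul, hL,
        smul_smul]

end FractionalChainMap

/-! ### Homotopies up to a denominator -/

/-- The map `ρ` on the `n`-th term of the complex factors over the differential. -/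
def FreeComplex.IsCoboundary (G : FreeComplex 𝒜) {N : GrMod 𝒜} :
    ∀ n, ((G.X n).carrier →ₗ[S] N.carrier) → Prop
  | 0, ρ => ρ = 0
  | n + 1, ρ => ∃ σ : (G.X n).carrier →ₗ[S] N.carrier, ρ = σ ∘ₗ (G.d n).toLin

theorem FreeComplex.IsCoboundary.comp_d {G : FreeComplex 𝒜} {N : GrMod 𝒜} :
    ∀ {n} {ρ : (G.X n).carrier →ₗ[S] N.carrier}, G.IsCoboundary n ρ → ρ ∘ₗ (G.d n).toLin = 0
  | 0, ρ, h => by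
    rw [show ρ = 0 from h, LinearMap.zero_comp]
  | n + 1, _, ⟨σ, h⟩ => by
    rw [h, LinearMap.comp_assoc, G.d_comp_d, LinearMap.comp_zero]

theorem FreeComplex.IsCoboundary.comp_left {G : FreeComplex 𝒜} {N N' : GrMod 𝒜}
    (α : N.carrier →ₗ[S] N'.carrier) :
    ∀ {n} {ρ : (G.X n).carrier →ₗ[S] N.carrier}, G.IsCoboundary n ρ → G.IsCoboundary n (α ∘ₗ ρ)
  | 0, ρ, h => by
    rw [show ρ = 0 from h, LinearMap.comp_zero]
    exact rfl
  | n + 1, _, ⟨σ, h⟩ => ⟨α ∘ₗ σ, by rw [h, LinearMap.comp_assoc]⟩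

/-- A homogeneous map of complexes that is zero on the augmentations is null-homotopic up to a
denominator. -/
theorem exists_homotopy [HasHomogeneousUnits 𝒜 B] {F G : FreeComplex 𝒜} {M : GrMod 𝒜}
    {ε : tilde B (F.X 0) ⟶ tilde B M} (hε : F.IsAugmentation ε) (P : RelSpec 𝒜 B) {c : A}
    (φ : ∀ j, (G.X j).carrier →ₗ[S] (F.X j).carrier) (hφ : ∀ j, HasDegree c (φ j))
    (h0 : ∀ x, stalkMap ε P (φ 0 x) = 0) : ∀ (n : ℕ)
    (_ : ∀ j < n, (F.d j).toLin ∘ₗ φ (j + 1) = φ j ∘ₗ (G.d j).toLin),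
    ∃ (C : A) (T : S) (h : (G.X n).carrier →ₗ[S] (F.X (n + 1)).carrier), T ∈ 𝒜 C ∧ T ∉ P.ideal ∧
      HasDegree (C + c) h ∧ G.IsCoboundary n (T • φ n - (F.d n).toLin ∘ₗ h)
  | 0, _ => by
    obtain ⟨C, T, h, hT, hTP, hh, e⟩ := exists_lift_of_isGrFree P (G.free 0) (F.d 0).toLin (φ 0) c
      (fun a x hx => hε.exact_zero.exists_of_stalkMap_eq_zero P (hφ 0 a x hx) (h0 x))
    exact ⟨C, T, h, hT, hTP, hh, sub_eq_zero.2 e.symm⟩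
  | n + 1, hc => by
    obtain ⟨C, T, h, hT, hTP, hh, e⟩ := exists_homotopy hε P φ hφ h0 n fun j hj => hc j (by omega)
    obtain ⟨C', T', h', hT', hTP', hh', e'⟩ := exists_lift_of_isGrFree P (G.free (n + 1))
      (F.d (n + 1)).toLin (T • φ (n + 1) - h ∘ₗ (G.d n).toLin) (C + c) (fun a x hx => by
        refine (hε.exact_succ n).exists_of_apply_eq_zero P
          ((((hφ (n + 1)).smul hT).sub (hh.comp_hom (G.d n))) a x hx) ?_
        -- The error term `T φ_n - d h` is a coboundary, so it vanishes on the image of `d`; hence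
        -- `d (T φ_{n+1} - h d) = (T φ_n - d h) d = 0`.
        have := e.comp_d
        rw [LinearMap.sub_comp, LinearMap.smul_comp, ← hc n (by omega), LinearMap.comp_assoc,
          ← LinearMap.comp_smul, ← LinearMap.comp_sub] at this
        exact LinearMap.congr_fun this x)
    -- The new error term is `T' T φ_{n+1} - d h' = T' h d`, which factors over `d` through `T' h`.
    refine ⟨C' + C, T' * T, h', SetLike.mul_mem_graded hT' hT, P.mul_notMem hTP' hTP,
      (add_assoc C' C c).symm ▸ hh', T' • h, ?_⟩
    rw [e', smul_sub, smul_smul, LinearMap.smul_comp]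
    abel
/-! ### Cohomology classes and pullback -/

namespace FreeComplex

variable (F : FreeComplex 𝒜) {N : GrMod 𝒜} {i : ℕ}

theorem mem_coboundaries_iff (α : (F.X i).carrier →ₗ[S] N.carrier) :
    α ∈ F.coboundaries N i ↔ F.IsCoboundary i α := by
  cases i with
  | zero => exact Submodule.mem_bot S (M := ((F.X 0).homGr N (F.free 0)).carrier)
  | succ i => exact ⟨fun ⟨σ, h⟩ => ⟨σ, h.symm⟩, fun ⟨σ, h⟩ => ⟨σ, h.symm⟩⟩

/-- The cohomology class of a cocycle. -/
def cohClass (α : (F.X i).carrier →ₗ[S] N.carrier) (hα : α ∘ₗ (F.d i).toLin = 0) :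
    (F.homCohomology N i).carrier :=
  Submodule.Quotient.mk ⟨α, hα⟩

theorem exists_cohClass (x : (F.homCohomology N i).carrier) :
    ∃ α hα, F.cohClass (N := N) (i := i) α hα = x := by
  obtain ⟨z, rfl⟩ := Submodule.Quotient.mk_surjective _ x
  exact ⟨z.1, z.2, rfl⟩

theorem exists_cohClass_of_mem {x : (F.homCohomology N i).carrier} {a : A}
    (hx : x ∈ (F.homCohomology N i).deg a) :
    ∃ α hα, HasDegree a α ∧ F.cohClass (N := N) (i := i) α hα = x := by
  obtain ⟨z, hz, rfl⟩ := hx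
  exact ⟨z.1, z.2, hz, rfl⟩

theorem cohClass_mem {α : (F.X i).carrier →ₗ[S] N.carrier} (hα : α ∘ₗ (F.d i).toLin = 0) {a : A}
    (h : HasDegree a α) : F.cohClass α hα ∈ (F.homCohomology N i).deg a :=
  ⟨⟨α, hα⟩, h, rfl⟩

theorem smul_cohClass (s : S) {α : (F.X i).carrier →ₗ[S] N.carrier}
    (hα : α ∘ₗ (F.d i).toLin = 0) :
    s • F.cohClass α hα = F.cohClass (s • α) (by rw [LinearMap.smul_comp, hα, smul_zero]) :=
  rfl

theorem cohClass_eq_iff {α β : (F.X i).carrier →ₗ[S] N.carrier}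
    (hα : α ∘ₗ (F.d i).toLin = 0) (hβ : β ∘ₗ (F.d i).toLin = 0) :
    F.cohClass α hα = F.cohClass β hβ ↔ F.IsCoboundary i (α - β) := by
  rw [← mem_coboundaries_iff]
  exact Submodule.Quotient.eq _

end FreeComplex

namespace FractionalChainMap

variable {n : ℕ} {F G H : FreeComplex 𝒜}

theorem comp_map_comp_d (L : FractionalChainMap n G F) {N : GrMod 𝒜} {i : ℕ} (hi : i < n)
    {α : (F.X i).carrier →ₗ[S] N.carrier} (hα : α ∘ₗ (F.d i).toLin = 0) :
    (α ∘ₗ L.map i) ∘ₗ (G.d i).toLin = 0 := by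
  rw [LinearMap.comp_assoc, ← L.comm i hi, ← LinearMap.comp_assoc, hα, LinearMap.zero_comp]

theorem isCoboundary_comp_map (L : FractionalChainMap n G F) {N : GrMod 𝒜} {i : ℕ} (hi : i < n)
    {α : (F.X i).carrier →ₗ[S] N.carrier} (hα : F.IsCoboundary i α) :
    G.IsCoboundary i (α ∘ₗ L.map i) := by
  cases i with
  | zero =>
    rw [show α = 0 from hα, LinearMap.zero_comp]
    exact rfl
  | succ i =>
    obtain ⟨σ, rfl⟩ := hα
    exact ⟨σ ∘ₗ L.map i, by
      rw [LinearMap.comp_assoc, L.comm i (by omega), LinearMap.comp_assoc]⟩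

/-- The map on cohomology induced by a fractional chain map. -/
def pullback (L : FractionalChainMap n G F) (N : GrMod 𝒜) {i : ℕ} (hi : i < n) :
    (F.homCohomology N i).carrier →ₗ[S] (G.homCohomology N i).carrier :=
  Submodule.mapQ _ _ ((LinearMap.lcomp S N.carrier (L.map i)).restrict
    (p := LinearMap.ker (F.coboundary N i).toLin) (q := LinearMap.ker (G.coboundary N i).toLin)
    fun _ hα => L.comp_map_comp_d hi hα) fun _ hα =>
      (G.mem_coboundaries_iff _).2 (L.isCoboundary_comp_map hi ((F.mem_coboundaries_iff _).1 hα))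

theorem pullback_cohClass (L : FractionalChainMap n G F) {N : GrMod 𝒜} {i : ℕ} (hi : i < n)
    {α : (F.X i).carrier →ₗ[S] N.carrier} (hα : α ∘ₗ (F.d i).toLin = 0) :
    L.pullback N hi (F.cohClass α hα) = G.cohClass (α ∘ₗ L.map i) (L.comp_map_comp_d hi hα) :=
  rfl

theorem hasDegree_pullback (L : FractionalChainMap n G F) (N : GrMod 𝒜) {i : ℕ} (hi : i < n) :
    HasDegree (M := F.homCohomology N i) (N := G.homCohomology N i) L.shift (L.pullback N hi) := by
  intro a x hx
  obtain ⟨α, hα, h, rfl⟩ := F.exists_cohClass_of_mem hx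
  rw [pullback_cohClass, add_comm]
  exact G.cohClass_mem _ (h.comp (L.hasDegree i))

theorem pullback_id (N : GrMod 𝒜) {i : ℕ} (hi : i < n) (x : (F.homCohomology N i).carrier) :
    (id n F).pullback N hi x = x := by
  obtain ⟨α, hα, rfl⟩ := F.exists_cohClass x
  rfl

theorem pullback_comp (K : FractionalChainMap n G F) (L : FractionalChainMap n H G) (N : GrMod 𝒜)
    {i : ℕ} (hi : i < n) (x : (F.homCohomology N i).carrier) :
    (K.comp L).pullback N hi x = L.pullback N hi (K.pullback N hi x) := by
  obtain ⟨α, hα, rfl⟩ := F.exists_cohClass x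
  rfl

variable [HasHomogeneousUnits 𝒜 B] {M : GrMod 𝒜} {ε : tilde B (F.X 0) ⟶ tilde B M}
  {ε' : tilde B (G.X 0) ⟶ tilde B M} {P : RelSpec 𝒜 B}

/-- The difference of the lifts, each multiplied by the other's denominator, is zero on the
augmentations and so null-homotopic up to some `T ∉ P`. Thus pullback divided by the denominator
does not depend on the lift. -/
theorem IsLift.pullback_eq (hε : F.IsAugmentation ε) {L L' : FractionalChainMap n G F}
    (hL : L.IsLift ε' ε P) (hL' : L'.IsLift ε' ε P) (N : GrMod 𝒜) {i : ℕ} (hi : i < n)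
    (x : (F.homCohomology N i).carrier) :
    L'.denom • P.toLoc _ (L.pullback N hi x) = L.denom • P.toLoc _ (L'.pullback N hi x) := by
  obtain ⟨α, hα, rfl⟩ := F.exists_cohClass x
  obtain ⟨C, T, h, hT, hTP, hh, e⟩ := exists_homotopy hε P (c := L'.shift + L.shift)
    (fun j => L'.denom • L.map j - L.denom • L'.map j)
    (fun j => ((L.hasDegree j).smul L'.denom_mem).sub
      (by rw [add_comm]; exact (L'.hasDegree j).smul L.denom_mem))
    (fun x => by
      simp only [LinearMap.sub_apply, LinearMap.smul_apply, map_sub, map_smul, hL.2, hL'.2]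
      rw [smul_comm, sub_self]) i (fun j hj => by
      rw [LinearMap.comp_sub, LinearMap.comp_smul, LinearMap.comp_smul, L.comm j (by omega),
        L'.comm j (by omega), LinearMap.sub_comp, LinearMap.smul_comp, LinearMap.smul_comp])
  rw [← (P.toLoc _).map_smul, ← (P.toLoc _).map_smul, RelSpec.toLoc_eq_iff]
  refine ⟨T, hTP, ?_⟩
  rw [pullback_cohClass, pullback_cohClass, FreeComplex.smul_cohClass, FreeComplex.smul_cohClass,
    FreeComplex.smul_cohClass, FreeComplex.smul_cohClass, FreeComplex.cohClass_eq_iff]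
  -- Composed with the cocycle `α`, the homotopy term `d h` disappears, and `T` times the difference
  -- is left as a coboundary.
  have := e.comp_left α
  rw [LinearMap.comp_sub, ← LinearMap.comp_assoc, hα, LinearMap.zero_comp, sub_zero,
    LinearMap.comp_smul, LinearMap.comp_sub, LinearMap.comp_smul, LinearMap.comp_smul,
    smul_sub] at this
  exact this

end FractionalChainMap

/-! ### Comparison of the cohomology sheaves -/

theorem exists_comparison [HasHomogeneousUnits 𝒜 B] {F G : FreeComplex 𝒜} {M : GrMod 𝒜}
    {ε : tilde B (F.X 0) ⟶ tilde B M} {ε' : tilde B (G.X 0) ⟶ tilde B M}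
    (hε : F.IsAugmentation ε) (hε' : G.IsAugmentation ε') (N : GrMod 𝒜) (i : ℕ)
    (P : RelSpec 𝒜 B) :
    ∃ Φ : P.Loc (F.homCohomology N i).carrier →ₗ[S] P.Loc (G.homCohomology N i).carrier,
      ∀ L : FractionalChainMap (i + 1) G F, L.IsLift ε' ε P → ∀ x,
        L.denom • Φ (P.toLoc _ x) = P.toLoc _ (L.pullback N i.lt_succ_self x) := by
  -- The range is `i + 1` because a map on `H^i` needs the square between degrees `i + 1` and `i` to
  -- commute.
  obtain ⟨L, hL⟩ := FractionalChainMap.exists_isLift hε hε' P (i + 1)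
  let t : P.ideal.primeCompl := ⟨L.denom, hL.1⟩
  refine ⟨LocalizedModule.divBy t ∘ₗ
    ((LocalizedModule.map P.ideal.primeCompl (L.pullback N i.lt_succ_self)).restrictScalars S),
    fun L' hL' x => P.smul_left_cancel hL.1 ?_⟩
  rw [smul_comm, ← hL.pullback_eq hε hL' N i.lt_succ_self x]
  congr 1
  refine (LocalizedModule.mul_by_divBy t _).trans ?_
  exact LocalizedModule.map_mk _ _ _ _

/-- The comparison map between the localizations at `P` of the cohomology modules of two virtual
resolutions. -/
def comparison [HasHomogeneousUnits 𝒜 B] {F G : FreeComplex 𝒜} {M : GrMod 𝒜}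
    {ε : tilde B (F.X 0) ⟶ tilde B M} {ε' : tilde B (G.X 0) ⟶ tilde B M}
    (hε : F.IsAugmentation ε) (hε' : G.IsAugmentation ε') (N : GrMod 𝒜) (i : ℕ)
    (P : RelSpec 𝒜 B) :
    P.Loc (F.homCohomology N i).carrier →ₗ[S] P.Loc (G.homCohomology N i).carrier :=
  (exists_comparison hε hε' N i P).choose

theorem RelSpec.linearMap_ext (P : RelSpec 𝒜 B) {M N : Type u} [AddCommGroup M] [Module S M]
    [AddCommGroup N] [Module S N] {f g : P.Loc M →ₗ[S] P.Loc N}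
    (h : ∀ m, f (P.toLoc M m) = g (P.toLoc M m)) : f = g := by
  ext x
  induction x using LocalizedModule.induction_on with
  | h m t =>
    refine P.smul_left_cancel t.2 ?_
    rw [← map_smul, ← map_smul]
    have := P.smul_frac m t.2
    exact (congrArg f this).trans ((h m).trans (congrArg g this).symm)

section

variable [HasHomogeneousUnits 𝒜 B] {F G : FreeComplex 𝒜} {M : GrMod 𝒜}
    {ε : tilde B (F.X 0) ⟶ tilde B M} {ε' : tilde B (G.X 0) ⟶ tilde B M}
    (hε : F.IsAugmentation ε) (hε' : G.IsAugmentation ε') (N : GrMod 𝒜) (i : ℕ)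
    (P : RelSpec 𝒜 B)

theorem denom_smul_comparison {L : FractionalChainMap (i + 1) G F} (hL : L.IsLift ε' ε P)
    (x : (F.homCohomology N i).carrier) :
    L.denom • comparison hε hε' N i P (P.toLoc _ x) =
      P.toLoc _ (L.pullback N i.lt_succ_self x) :=
  (exists_comparison hε hε' N i P).choose_spec L hL x

/-- The composite of a lift `G → F` with a lift `F → G` and the identity of `F` both lift the same
augmentation, so they induce the same map after division by denominators. -/
theorem comparison_comp_comparison (x : P.Loc (F.homCohomology N i).carrier) :
    comparison hε' hε N i P (comparison hε hε' N i P x) = x := by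
  suffices h : comparison hε' hε N i P ∘ₗ comparison hε hε' N i P = LinearMap.id from
    LinearMap.congr_fun h x
  refine P.linearMap_ext fun x => ?_
  obtain ⟨L, hL⟩ := FractionalChainMap.exists_isLift hε hε' P (i + 1)
  obtain ⟨K, hK⟩ := FractionalChainMap.exists_isLift hε' hε P (i + 1)
  have h := (hL.comp hK).pullback_eq hε (FractionalChainMap.isLift_id ε P) N i.lt_succ_self x
  rw [FractionalChainMap.pullback_id, FractionalChainMap.pullback_comp,
    ← denom_smul_comparison hε' hε N i P hK, ← denom_smul_comparison hε hε' N i P hL] at h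
  rw [map_smul] at h
  have h' : ∀ z : P.Loc (F.homCohomology N i).carrier,
      (L.comp K).denom • z = (1 : S) • K.denom • L.denom • z := fun z => by
    rw [one_smul, smul_smul, mul_comm]
    rfl
  exact P.smul_left_cancel (hL.comp hK).1 ((h' _).trans h)

end

/-! ### Gluing maps of stalks to morphisms of sheaves -/

/-- A family of maps between the stalks that locally are given by fractional homogeneous maps. -/
structure StalkFamily (B : Ideal S) (M N : GrMod 𝒜) where
  map : ∀ P : RelSpec 𝒜 B, P.Loc M.carrier →ₗ[S] P.Loc N.carrier
  exists_fraction : ∀ P : RelSpec 𝒜 B, ∃ (c : A) (t : S) (f : M.carrier →ₗ[S] N.carrier),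
    t ∈ 𝒜 c ∧ HasDegree c f ∧
      ∀ᶠ Q in nhds P, t ∉ Q.ideal ∧ ∀ m, t • map Q (Q.toLoc _ m) = Q.toLoc _ (f m)

namespace StalkFamily

variable {M N : GrMod 𝒜}

/-- The map on sections of a family of maps between stalks. -/
def mapSections (Φ : StalkFamily B M N) (U : Opens (RelSpec 𝒜 B)) :
    ModSec M U →ₗ[RingSec U] ModSec N U where
  toFun s := ⟨fun x => Φ.map x.1 (s.1 x), fun x => by
    obtain ⟨V, hV, i, a, m, hm, r, hr, hrV, hs⟩ := s.exists_frac x.2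
    obtain ⟨c, t, f, ht, hf, h⟩ := Φ.exists_fraction x.1
    obtain ⟨W, hW, hWo, hxW⟩ := eventually_nhds_iff.1 h
    -- If the family is `f / t` and the section is `m / r` near the point, the image is `f(m) / (t
    -- r)`, again of degree `0` because `f` and `t` have the same degree.
    refine ⟨V ⊓ ⟨W, hWo⟩, ⟨hV, hxW⟩, inf_le_left.trans i, c + a, f m, hf a m hm, t * r,
      SetLike.mul_mem_graded ht hr, fun y => ?_⟩
    have hy : t * r ∉ y.1.ideal := y.1.mul_notMem (hW y y.2.2).1 (hrV y y.2.1)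
    refine ⟨hy, y.1.smul_left_cancel hy (Eq.trans ?_ (y.1.smul_frac (f m) hy).symm)⟩
    rw [← (hW y y.2.2).2 m, mul_smul, ← y.1.smul_frac m (hrV y y.2.1), map_smul]
    exact congrArg (fun z => t • r • Φ.map y.1 z) (hs ⟨y, y.2.1⟩)⟩
  map_add' s t := Subtype.ext <| funext fun x => map_add (Φ.map x.1) _ _
  map_smul' r s := Subtype.ext <| funext fun x => by
    change Φ.map x.1 (r.1 x • s.1 x) = r.1 x • Φ.map x.1 (s.1 x)
    generalize s.1 x = z
    induction r.1 x using LocalizedModule.induction_on with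
    | h c t =>
      refine x.1.smul_left_cancel t.2 ?_
      rw [← map_smul]
      exact ((congrArg (Φ.map x.1) (x.1.smul_frac_smul c t.2 z)).trans (map_smul _ _ _)).trans
        (x.1.smul_frac_smul c t.2 _).symm

/-- The morphism of sheaves given by a family of maps between stalks. -/
def toHom (Φ : StalkFamily B M N) : tilde B M ⟶ tilde B N where
  val := PresheafOfModules.homMk
    { app := fun U => AddCommGrpCat.ofHom (Φ.mapSections U.unop).toAddMonoidHom
      naturality := fun _ _ _ => rfl } fun U r m => (Φ.mapSections U.unop).map_smul r m

/-- Inverse families of maps between stalks give an isomorphism of sheaves. -/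
def toIso (Φ : StalkFamily B M N) (Ψ : StalkFamily B N M)
    (h : ∀ P x, Ψ.map P (Φ.map P x) = x) (h' : ∀ P x, Φ.map P (Ψ.map P x) = x) :
    tilde B M ≅ tilde B N where
  hom := Φ.toHom
  inv := Ψ.toHom
  hom_inv_id := tilde_hom_ext fun _ s => Subtype.ext <| funext fun x => h x.1 (s.1 x)
  inv_hom_id := tilde_hom_ext fun _ s => Subtype.ext <| funext fun x => h' x.1 (s.1 x)

end StalkFamily

/-- The comparison maps between the cohomology modules of two virtual resolutions. -/
def comparisonFamily [HasHomogeneousUnits 𝒜 B] {F G : FreeComplex 𝒜} {M : GrMod 𝒜}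
    {ε : tilde B (F.X 0) ⟶ tilde B M} {ε' : tilde B (G.X 0) ⟶ tilde B M}
    (hε : F.IsAugmentation ε) (hε' : G.IsAugmentation ε') (N : GrMod 𝒜) (i : ℕ) :
    StalkFamily B (F.homCohomology N i) (G.homCohomology N i) where
  map := comparison hε hε' N i
  exists_fraction P := by
    obtain ⟨L, hL⟩ := FractionalChainMap.exists_isLift hε hε' P (i + 1)
    refine ⟨L.shift, L.denom, L.pullback N i.lt_succ_self, L.denom_mem, L.hasDegree_pullback N _, ?_⟩
    -- A single lift, chosen at `P`, computes the comparison maps at all nearby points, although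
    -- those maps were defined through independent choices.
    filter_upwards [hL.eventually] with Q hQ
    exact ⟨hQ.1, denom_smul_comparison hε hε' N i Q hQ⟩

/-- Two virtual resolutions of the same module have isomorphic cohomology sheaves. -/
theorem IsVirtualResolution.nonempty_iso [HasHomogeneousUnits 𝒜 B] {F G : FreeComplex 𝒜}
    {M : GrMod 𝒜} (hF : IsVirtualResolution B F M) (hG : IsVirtualResolution B G M) (N : GrMod 𝒜)
    (i : ℕ) : Nonempty (tilde B (F.homCohomology N i) ≅ tilde B (G.homCohomology N i)) := by
  obtain ⟨ε, h1, h2, h3⟩ := hF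
  obtain ⟨ε', h1', h2', h3'⟩ := hG
  have hε : F.IsAugmentation ε := ⟨h1, h2, h3⟩
  have hε' : G.IsAugmentation ε' := ⟨h1', h2', h3'⟩
  exact ⟨(comparisonFamily hε hε' N i).toIso (comparisonFamily hε' hε N i)
    (comparison_comp_comparison hε hε' N i) (comparison_comp_comparison hε' hε N i)⟩

theorem tilde_isZero (M : GrMod 𝒜) [Subsingleton M.carrier] : Limits.IsZero (tilde B M) := by
  rw [Limits.IsZero.iff_id_eq_zero]
  refine tilde_hom_ext fun U s => Subtype.ext <| funext fun x => ?_
  exact Subsingleton.elim (α := x.1.Loc M.carrier) _ _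

theorem FreeComplex.LengthLE.subsingleton_homCohomology {F : FreeComplex 𝒜} {l : ℕ}
    (hF : F.LengthLE l) (N : GrMod 𝒜) {i : ℕ} (hi : l < i) :
    Subsingleton (F.homCohomology N i).carrier := by
  have := hF i hi
  refine ⟨fun x y => ?_⟩
  obtain ⟨α, hα, rfl⟩ := F.exists_cohClass x
  obtain ⟨β, hβ, rfl⟩ := F.exists_cohClass y
  congr 1
  exact LinearMap.ext fun z => by rw [Subsingleton.elim z 0, map_zero, map_zero]

end

/-! ### The Cox ring of a smooth toric variety -/

namespace SmoothProjectiveFan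

variable {n : ℕ} {ι : Type} [Fintype ι] [DecidableEq ι] (X : SmoothProjectiveFan n ι)

/-- Every divisor class is represented by a divisor that is supported outside of a given cone. -/
theorem exists_representative {σ : Finset ι} (hσ : σ ∈ X.maxCones) (a : X.Pic) :
    ∃ D : ι → ℤ, (∀ i ∈ σ, D i = 0) ∧ Submodule.Quotient.mk D = a := by
  obtain ⟨D, rfl⟩ := Submodule.Quotient.mk_surjective _ a
  let b := Module.Basis.mk (X.linearIndependent σ hσ) (X.span_eq_top σ hσ).ge
  -- By smoothness the rays of `σ` are a lattice basis, so some character takes the values of `D` on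
  -- them; subtracting its divisor clears `D` on `σ`.
  let m : Module.Dual ℤ (Fin n → ℤ) := b.constr ℤ fun i : σ => D i
  refine ⟨D - X.divMap m, fun i hi => ?_, ?_⟩
  · have : m (X.ray i) = D i := by
      have h := b.constr_basis ℤ (fun i : σ => D i) ⟨i, hi⟩
      rwa [Module.Basis.mk_apply] at h
    change D i - m (X.ray i) = 0
    rw [this, sub_self]
  · rw [Submodule.Quotient.eq]
    exact ⟨-m, by rw [map_neg]; abel⟩

theorem mk_eq_sum_rayClass (D : ι → ℤ) :
    (Submodule.Quotient.mk D : X.Pic) = ∑ i, D i • X.rayClass i := by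
  conv_lhs => rw [show D = ∑ i, D i • Pi.single i (1 : ℤ) by
    simpa using (pi_eq_sum_univ' D)]
  rw [← Submodule.mkQ_apply, map_sum]
  simp only [map_zsmul]
  rfl

variable (k : Type u) [Field k]

theorem prod_pow_mem_coxGrading (e : ι → ℕ) :
    ∏ i, (MvPolynomial.X i : MvPolynomial ι k) ^ e i ∈ X.coxGrading k (∑ i, e i • X.rayClass i) :=
  SetLike.prod_pow_mem_graded (X.coxGrading k) X.rayClass _ e fun i _ =>
    MvPolynomial.isWeightedHomogeneous_X k X.rayClass i

/-- As `P` does not contain the irrelevant ideal, it lies in the chart of some maximal cone `σ`,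
where the variables outside `σ` do not vanish. A class represented by a divisor `D` supported off
`σ` is then the degree of a Laurent monomial in these variables. -/
instance hasHomogeneousUnits : HasHomogeneousUnits (X.coxGrading k) (X.irrelevantIdeal k) where
  exists_unit P a := by
    obtain ⟨σ, hσ, hP⟩ : ∃ σ ∈ X.maxCones, (∏ i ∈ σᶜ, MvPolynomial.X i : MvPolynomial ι k) ∉
        P.ideal := by
      by_contra! h
      refine P.2.2 (Ideal.span_le.2 ?_)
      rintro _ ⟨σ, hσ, rfl⟩
      exact h σ hσ
    have hX : ∀ i, i ∉ σ → (MvPolynomial.X i : MvPolynomial ι k) ∉ P.ideal := fun i hi h =>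
      hP (Ideal.mem_of_dvd _ (Finset.dvd_prod_of_mem _ (Finset.mem_compl.2 hi)) h)
    have hpow : ∀ e : ι → ℕ, (∀ i ∈ σ, e i = 0) →
        ∏ i, (MvPolynomial.X i : MvPolynomial ι k) ^ e i ∉ P.ideal := by
      intro e he
      refine P.ideal.primeCompl.prod_mem fun i _ => ?_
      by_cases hi : i ∈ σ
      · rw [he i hi, pow_zero]
        exact one_mem _
      · exact pow_mem (hX i hi) _
    obtain ⟨D, hD, rfl⟩ := X.exists_representative hσ a
    -- The numerator and denominator are the monomials of the positive and negative parts of `D`.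
    refine ⟨∑ i, (-D i).toNat • X.rayClass i, ∏ i, MvPolynomial.X i ^ (D i).toNat,
      ∏ i, MvPolynomial.X i ^ (-D i).toNat, ?_, X.prod_pow_mem_coxGrading k _,
      hpow _ fun i hi => by rw [hD i hi]; rfl, hpow _ fun i hi => by rw [hD i hi]; rfl⟩
    have h := X.prod_pow_mem_coxGrading k fun i => (D i).toNat
    rwa [show ∑ i, (D i).toNat • X.rayClass i =
      ∑ i, (-D i).toNat • X.rayClass i + Submodule.Quotient.mk D by
        rw [mk_eq_sum_rayClass, ← Finset.sum_add_distrib]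
        refine Finset.sum_congr rfl fun i _ => ?_
        rw [← natCast_zsmul, ← natCast_zsmul, ← add_smul]
        congr 1
        omega] at h

end SmoothProjectiveFan

theorem mainTheorem5 {k : Type u} [Field k] [IsAlgClosed k] {n : ℕ} {ι : Type} [Fintype ι]
    [DecidableEq ι] (X : SmoothProjectiveFan n ι) (M : X.CoxModule k)
    [Module.Finite (MvPolynomial ι k) M.carrier] :
    (∀ F : FreeComplex (X.coxGrading k), IsVirtualResolution (X.irrelevantIdeal k) F M →
      ∀ (N : X.CoxModule k) [Module.Finite (MvPolynomial ι k) N.carrier] (i : ℕ),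
        Nonempty (X.sheaf (M.gradedExt N i) ≅ X.sheaf (F.homCohomology N i))) ∧
    (∀ l : ℕ, (∃ F : FreeComplex (X.coxGrading k),
        IsVirtualResolution (X.irrelevantIdeal k) F M ∧ F.LengthLE l) →
      ∀ (N : X.CoxModule k) [Module.Finite (MvPolynomial ι k) N.carrier] (i : ℕ), l < i →
        Limits.IsZero (X.sheaf (M.gradedExt N i))) := by
  have key : ∀ F : FreeComplex (X.coxGrading k), IsVirtualResolution (X.irrelevantIdeal k) F M →
      ∀ (N : X.CoxModule k) (i : ℕ),
        Nonempty (X.sheaf (M.gradedExt N i) ≅ X.sheaf (F.homCohomology N i)) := fun F hF N i =>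
    (M.freeResolution_isVirtualResolution inferInstance).nonempty_iso hF N i
  refine ⟨fun F hF N _ i => key F hF N i, ?_⟩
  rintro l ⟨F, hF, hl⟩ N _ i hi
  have := hl.subsingleton_homCohomology N hi
  -- Vanishing is read off from the short virtual resolution and transported to `Ext` along the
  -- isomorphism of the first part.
  exact (tilde_isZero (F.homCohomology N i)).of_iso (key F hF N i).some
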